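/- Let $\mathbb{K}$ be a field of characteristic zero. A noncrossing partition is a partition $\pi$ of $[N]=\{1,\dots,N\}$, for some $N\ge 1$, such that there are no two distinct blocks $b\neq b'$ and $x,z\in b$, $y,t\in b'$ with $x<y<z<t$. For a set $B$ of blocks of $\pi$, let $\pi_{|B}$ be the noncrossing partition obtained by deleting the blocks not in $B$ and renumbering increasingly the remaining elements, with $\pi_{|\emptyset}=1$. Let $\mathbb{K}[\mathcal{NCP}]$ be the free commutative algebra generated by the noncrossing partitions, with the two coproducts that are algebra morphisms and satisfy, for every noncrossing partition $\pi$, $$\Delta(\pi)=\sum_{J}\pi_{|\pi\setminus J}\otimes \prod_{C}\pi_{|\{b\in J\,:\,b\subseteq C\}},\qquad \delta(\pi)=\sum_{\sim}\pi/{\sim}\otimes\prod_{c\in\pi/\sim}\pi_{|c}.$$ Here $J$ runs over the ideals of $\pi$, i.e. the sets $J$ of blocks of $\pi$ such that every connected component (maximal interval of integers) $C$ of $\bigcup_{b\in J}b$ is a union of blocks of $\pi$, and the product in $\Delta(\pi)$ is over these components $C$; $\sim$ runs over the equivalence relations on the set of blocks of $\pi$ such that the partition $\pi/{\sim}$, obtained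 by merging the blocks of each class, is noncrossing, and the product in $\delta(\pi)$ is over the classes $c$ of $\sim$. The counits are the algebra morphisms $\varepsilon_\Delta$, sending every $\pi$ to $0$, and $\epsilon_\delta$, sending $\pi$ to $1$ if it has exactly one block and to $0$ otherwise. Let $\mathbb{K}[X]$ carry the multiplicative coproducts with $\Delta(X)=X\otimes 1+1\otimes X$ and $\delta(X)=X\otimes X$, with counits $P\mapsto P(0)$ and $P\mapsto P(1)$. A double bialgebra morphism is an algebra morphism compatible with both coproducts and both counits. There exists a unique double bialgebra morphism $\phi_{\mathcal{NCP}}:\mathbb{K}[\mathcal{NCP}]\to\mathbb{K}[X]$. Moreover, for every noncrossing partition $\pi$ and every integer $n\ge 1$, $\phi_{\mathcal{NCP}}(\pi)(n)$ is the number of maps $f$ from the set of blocks of $\pi$ to $[n]$ (the valid $n$-colorations of $\pi$) such that, for all blocks $b,b'$ of $\pi$: - if $b'\subseteq[\min(b),\max(b)]$ and $b\neq b'$, then $f(b)<f(b')$; - if $f(b)=f(b')$ and $\max(b)<\min(b')$, then there exists a block $b''$ of $\pi$ containing an element of the open interval $]\max(b),\min(b')[$, such that $f(b'')<f(b)=f(b')$.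 -/

import Mathlib

open scoped TensorProduct

namespace NoncrossingPartitions

/-- A finite set `B` of finite sets of integers is *noncrossing* when there are no two distinct
members `b ≠ b'` and `x, z ∈ b`, `y, t ∈ b'` with `x < y < z < t`. -/
def IsNoncrossing (B : Finset (Finset ℕ)) : Prop :=
  ∀ b ∈ B, ∀ b' ∈ B, b ≠ b' →
    ∀ x ∈ b, ∀ z ∈ b, ∀ y ∈ b', ∀ t ∈ b', ¬(x < y ∧ y < z ∧ z < t)

/-- A noncrossing partition: a partition of `[size] = {1, …, size}`, with `size ≥ 1`, whose set of
blocks is noncrossing. -/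
structure NCP where
  size : ℕ
  size_pos : 0 < size
  part : Finpartition (Finset.Icc 1 size)
  noncrossing : IsNoncrossing part.parts

/-- The set of blocks of a noncrossing partition. -/
def NCP.blocks (π : NCP) : Finset (Finset ℕ) := π.part.parts

/-- `B` is the set of blocks of a noncrossing partition of the finite set of integers `⋃ B`. -/
structure IsNCFamily (B : Finset (Finset ℕ)) : Prop where
  empty_notMem : ∅ ∉ B
  pairwiseDisjoint : (B : Set (Finset ℕ)).PairwiseDisjoint id
  noncrossing : IsNoncrossing B

/-! ### Standardization -/

/-- The map whose restriction to `S` is the unique increasing bijection from `S` to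
`{1, …, |S|}`. -/
def rank (S : Finset ℕ) (x : ℕ) : ℕ := (S.filter (· ≤ x)).card

lemma rank_lt_rank {S : Finset ℕ} {x y : ℕ} (hy : y ∈ S) (h : x < y) : rank S x < rank S y := by
  apply Finset.card_lt_card
  rw [Finset.ssubset_iff_of_subset]
  · exact ⟨y, by simp [hy], by simp [h]⟩
  · intro z hz
    simp only [Finset.mem_filter] at hz ⊢
    exact ⟨hz.1, hz.2.trans h.le⟩

lemma rank_lt_rank_iff {S : Finset ℕ} {x y : ℕ} (hx : x ∈ S) (hy : y ∈ S) :
    rank S x < rank S y ↔ x < y := by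
  refine ⟨fun h => ?_, rank_lt_rank hy⟩
  by_contra hxy
  rcases (not_lt.mp hxy).lt_or_eq with h' | h'
  · exact absurd (rank_lt_rank hx h') (by omega)
  · subst h'; omega

lemma rank_injOn (S : Finset ℕ) : Set.InjOn (rank S) (S : Set ℕ) := by
  intro x hx y hy h
  rcases lt_trichotomy x y with h' | h' | h'
  · exact absurd (rank_lt_rank hy h') (by omega)
  · exact h'
  · exact absurd (rank_lt_rank hx h') (by omega)

lemma image_rank (S : Finset ℕ) : S.image (rank S) = Finset.Icc 1 S.card := by
  apply Finset.eq_of_subset_of_card_le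
  · intro k hk
    obtain ⟨x, hx, rfl⟩ := Finset.mem_image.mp hk
    rw [Finset.mem_Icc]
    exact ⟨Finset.card_pos.mpr ⟨x, by simp [hx]⟩, Finset.card_le_card (Finset.filter_subset _ _)⟩
  · rw [Finset.card_image_of_injOn (rank_injOn S)]
    simp

lemma subset_sup {B : Finset (Finset ℕ)} {b : Finset ℕ} (hb : b ∈ B) : b ⊆ B.sup id :=
  Finset.le_sup (f := id) hb

/-- The noncrossing partition of `{1, …, |⋃ B|}` obtained from a noncrossing partition `B` of the
nonempty set of integers `⋃ B` by applying to each block the increasing bijection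
`⋃ B → {1, …, |⋃ B|}`. -/
def IsNCFamily.std {B : Finset (Finset ℕ)} (h : IsNCFamily B) (hB : B.Nonempty) : NCP where
  size := (B.sup id).card
  size_pos := by
    obtain ⟨b, hb⟩ := hB
    obtain ⟨x, hx⟩ : b.Nonempty :=
      Finset.nonempty_iff_ne_empty.mpr fun h0 => h.empty_notMem (h0 ▸ hb)
    exact Finset.card_pos.mpr ⟨x, subset_sup hb hx⟩
  part :=
    { parts := B.image fun b => b.image (rank (B.sup id))
      supIndep := by
        rw [Finset.supIndep_iff_pairwiseDisjoint]
        intro c hc c' hc' hne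
        obtain ⟨b, hb, rfl⟩ := Finset.mem_image.mp (Finset.mem_coe.mp hc)
        obtain ⟨b', hb', rfl⟩ := Finset.mem_image.mp (Finset.mem_coe.mp hc')
        have hbb : b ≠ b' := fun e => hne (by rw [e])
        have hd : Disjoint b b' := h.pairwiseDisjoint hb hb' hbb
        simp only [Function.onFun, id]
        rw [Finset.disjoint_left]
        intro k hk hk'
        obtain ⟨x, hx, rfl⟩ := Finset.mem_image.mp hk
        obtain ⟨y, hy, hxy⟩ := Finset.mem_image.mp hk'
        have : y = x := rank_injOn _ (subset_sup hb' hy) (subset_sup hb hx) hxy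
        exact Finset.disjoint_left.mp hd hx (this ▸ hy)
      sup_parts := by
        rw [← image_rank]
        ext k
        simp only [Finset.mem_sup, Finset.mem_image, id]
        constructor
        · rintro ⟨c, ⟨b, hb, rfl⟩, hk⟩
          obtain ⟨x, hx, rfl⟩ := Finset.mem_image.mp hk
          exact ⟨x, ⟨b, hb, hx⟩, rfl⟩
        · rintro ⟨x, ⟨b, hb, hx⟩, rfl⟩
          exact ⟨_, ⟨b, hb, rfl⟩, Finset.mem_image_of_mem _ hx⟩
      bot_notMem := by
        intro h0
        obtain ⟨b, hb, hb0⟩ := Finset.mem_image.mp h0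
        have : b = ∅ := Finset.image_eq_empty.mp hb0
        exact h.empty_notMem (this ▸ hb) }
  noncrossing := by
    intro c hc c' hc' hne x hxc z hzc y hyc t htc
    obtain ⟨b, hb, rfl⟩ := Finset.mem_image.mp hc
    obtain ⟨b', hb', rfl⟩ := Finset.mem_image.mp hc'
    have hbb : b ≠ b' := fun e => hne (by rw [e])
    obtain ⟨x, hx, rfl⟩ := Finset.mem_image.mp hxc
    obtain ⟨z, hz, rfl⟩ := Finset.mem_image.mp hzc
    obtain ⟨y, hy, rfl⟩ := Finset.mem_image.mp hyc
    obtain ⟨t, ht, rfl⟩ := Finset.mem_image.mp htc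
    rw [rank_lt_rank_iff (subset_sup hb hx) (subset_sup hb' hy),
      rank_lt_rank_iff (subset_sup hb' hy) (subset_sup hb hz),
      rank_lt_rank_iff (subset_sup hb hz) (subset_sup hb' ht)]
    exact h.noncrossing b hb b' hb' hbb x hx z hz y hy t ht

/-! ### The algebra `K[NCP]` and its two coproducts -/

/-- `K[NCP]`: the free commutative algebra generated by the noncrossing partitions. -/
abbrev Alg (K : Type*) [Field K] : Type _ := MvPolynomial NCP K

open Classical in
/-- The element of `K[NCP]` attached to a set of blocks `B`: the generator `std B` if `B` is a
nonempty noncrossing family, and `1` if `B` is empty. For `B` a set of blocks of a noncrossing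
partition `π`, this is the restriction `π_{∣B}`, with the convention `π_{∣∅} = 1`.
(It is only used for noncrossing families.) -/
noncomputable def elt (K : Type*) [Field K] (B : Finset (Finset ℕ)) : Alg K :=
  if h : IsNCFamily B ∧ B.Nonempty then MvPolynomial.X (h.1.std h.2) else 1

open Classical in
/-- The connected components (maximal intervals of integers) of a finite set `S` of integers:
the component of `x` is the set of all `y` such that `S` contains all the integers between
`x` and `y`. -/
noncomputable def components (S : Finset ℕ) : Finset (Finset ℕ) :=
  S.image fun x => S.filter fun y => Finset.uIcc x y ⊆ S

/-- A set `J` of blocks of `π` is an ideal if each connected component of `⋃ J` is a union of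
blocks of `π`. -/
def IsIdeal (π : NCP) (J : Finset (Finset ℕ)) : Prop :=
  J ⊆ π.blocks ∧ ∀ C ∈ components (J.sup id), ∃ B ⊆ π.blocks, C = B.sup id

/-- `π_{∣· J}`, for `J` an ideal of a noncrossing partition `π`: the product over the connected
components `C` of `⋃ J` of the restrictions of `π` to the blocks included in `C`. -/
noncomputable def dotRestrict (K : Type*) [Field K] (J : Finset (Finset ℕ)) : Alg K :=
  ∏ C ∈ components (J.sup id), elt K (J.filter (· ⊆ C))

open Classical in
/-- The first coproduct: the algebra morphism with
`Δ(π) = ∑_{J ideal of π} π_{∣ π ∖ J} ⊗ π_{∣· J}`. -/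
noncomputable def coprodΔ (K : Type*) [Field K] : Alg K →ₐ[K] Alg K ⊗[K] Alg K :=
  MvPolynomial.aeval fun π =>
    ∑ J ∈ π.blocks.powerset with IsIdeal π J, elt K (π.blocks \ J) ⊗ₜ[K] dotRestrict K J

/-- The counit of `Δ`: the algebra morphism sending every noncrossing partition to `0`. -/
noncomputable def counitΔ (K : Type*) [Field K] : Alg K →ₐ[K] K :=
  MvPolynomial.aeval fun _ => 0

/-- The blocks of `π/∼`, where the equivalence `∼` on the blocks of `π` is given by the partition
of the set of blocks into its classes: the unions of the blocks in each class. -/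
def contract {π : NCP} (σ : Finpartition π.blocks) : Finset (Finset ℕ) :=
  σ.parts.image fun c => c.sup id

open Classical in
/-- The second coproduct: the algebra morphism with
`δ(π) = ∑_∼ π/∼ ⊗ ∏_{c class of ∼} π_{∣c}`, where `∼` runs over the equivalences on the set of
blocks of `π` such that `π/∼` is noncrossing. -/
noncomputable def coprodδ (K : Type*) [Field K] : Alg K →ₐ[K] Alg K ⊗[K] Alg K :=
  MvPolynomial.aeval fun π =>
    ∑ σ : Finpartition π.blocks with IsNoncrossing (contract σ),
      elt K (contract σ) ⊗ₜ[K] ∏ c ∈ σ.parts, elt K c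

/-- The counit of `δ`: the algebra morphism sending a noncrossing partition to `1` if it has
exactly one block, and to `0` otherwise. -/
noncomputable def counitδ (K : Type*) [Field K] : Alg K →ₐ[K] K :=
  MvPolynomial.aeval fun π => if π.blocks.card = 1 then 1 else 0

/-! ### The double bialgebra `K[X]` -/

/-- The coproduct of `K[X]` with `Δ(X) = X ⊗ 1 + 1 ⊗ X`. -/
noncomputable def polyΔ (K : Type*) [Field K] :
    Polynomial K →ₐ[K] Polynomial K ⊗[K] Polynomial K :=
  Polynomial.aeval (Polynomial.X ⊗ₜ[K] 1 + 1 ⊗ₜ[K] Polynomial.X)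

/-- The coproduct of `K[X]` with `δ(X) = X ⊗ X`. -/
noncomputable def polyδ (K : Type*) [Field K] :
    Polynomial K →ₐ[K] Polynomial K ⊗[K] Polynomial K :=
  Polynomial.aeval (Polynomial.X ⊗ₜ[K] Polynomial.X)

/-- The counit `P ↦ P(0)` of `Δ` on `K[X]`. -/
noncomputable def polyCounitΔ (K : Type*) [Field K] : Polynomial K →ₐ[K] K :=
  Polynomial.aeval 0

/-- The counit `P ↦ P(1)` of `δ` on `K[X]`. -/
noncomputable def polyCounitδ (K : Type*) [Field K] : Polynomial K →ₐ[K] K :=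
  Polynomial.aeval 1

/-- An algebra morphism `K[NCP] → K[X]` is a double bialgebra morphism if it is a bialgebra
morphism for both `Δ` and `δ`. -/
structure IsDoubleBialgHom {K : Type*} [Field K] (φ : Alg K →ₐ[K] Polynomial K) : Prop where
  map_Δ : (polyΔ K).comp φ = (Algebra.TensorProduct.map φ φ).comp (coprodΔ K)
  map_counitΔ : (polyCounitΔ K).comp φ = counitΔ K
  map_δ : (polyδ K).comp φ = (Algebra.TensorProduct.map φ φ).comp (coprodδ K)
  map_counitδ : (polyCounitδ K).comp φ = counitδ K

/-! ### Valid colorations -/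

lemma NCP.block_nonempty (π : NCP) (b : π.blocks) : b.1.Nonempty :=
  Finset.nonempty_iff_ne_empty.mpr (π.part.ne_bot b.2)

/-- The minimum of a block. -/
def NCP.bmin (π : NCP) (b : π.blocks) : ℕ := b.1.min' (π.block_nonempty b)

/-- The maximum of a block. -/
def NCP.bmax (π : NCP) (b : π.blocks) : ℕ := b.1.max' (π.block_nonempty b)

/-- The nesting order: `b ≤_π b'` if `b' ⊆ [min b, max b]`. -/
def NCP.nestLE (π : NCP) (b b' : π.blocks) : Prop :=
  b'.1 ⊆ Finset.Icc (π.bmin b) (π.bmax b)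

/-- Valid `n`-colorations of `π` (the set of colors `[n]` being the ordered set `Fin n`). -/
structure IsValidColoration (π : NCP) {n : ℕ} (f : π.blocks → Fin n) : Prop where
  increasing : ∀ b b' : π.blocks, π.nestLE b b' → b ≠ b' → f b < f b'
  bCondition : ∀ b b' : π.blocks, f b = f b' → π.bmax b < π.bmin b' →
    ∃ b'' : π.blocks,
      (Finset.Ioo (π.bmax b) (π.bmin b') ∩ b''.1).Nonempty ∧ f b'' < f b

end NoncrossingPartitions

/-! A word `g` on the positions `1, …, N` determines an equivalence (`fiberRel`): two positions are
related when they carry the same letter and no smaller letter occurs between them. The classes never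
cross. Extending a coloration of the blocks to a word constant on blocks identifies the valid
`n`-colorations of `π` with the words on `n` letters whose equivalence is `π`
(`card_isValidColoration`). So the morphism has to count words.

The number of such words is a polynomial in `n`, because the condition depends only on the relative
order of the letters: it is a combination of binomial coefficients `n.choose k`
(`exists_polynomial_eval_eq_card`).

Both coproducts then come from operations on the alphabet, and it suffices to check identities at
pairs of natural numbers (`tensor_ext_of_evalPair`). For `Δ`, cut `m + n` letters into `m` small and
`n` large ones: the blocks with large letters form an ideal, and distinct components of its support
do not interact (`famCount_eq_sum_ideals`). For `δ`, replace `m * n` letters by pairs in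
lexicographic order: first letters code a coarser noncrossing partition `π/∼`, and second letters
code the restriction of `π` to each class (`famCount_eq_sum_contract`). The counits correspond to
the alphabets with zero and one letter.

Uniqueness: evaluation at `0` and `1` is forced by the counits, and compatibility with `Δ` makes
evaluation at `n + 1` the convolution of the evaluations at `n` and `1`. -/

namespace NoncrossingPartitions

/-! ### Words and the noncrossing equivalence attached to a word -/

section Words

variable {X Y α β : Type*} [LinearOrder X] [LinearOrder Y] [LinearOrder α] [LinearOrder β]

/-- Two positions of a word `g` are related if they carry the same letter and no smaller letter
occurs between them. -/
def fiberRel (g : X → α) (x y : X) : Prop :=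
  g x = g y ∧ ∀ z ∈ Set.uIcc x y, g x ≤ g z

lemma fiberRel_refl (g : X → α) (x : X) : fiberRel g x x :=
  ⟨rfl, fun z hz => by simp only [Set.uIcc_self, Set.mem_singleton_iff] at hz; rw [hz]⟩

lemma fiberRel.symm {g : X → α} {x y : X} (h : fiberRel g x y) : fiberRel g y x :=
  ⟨h.1.symm, fun z hz => h.1 ▸ h.2 z (Set.uIcc_comm x y ▸ hz)⟩

lemma fiberRel.trans {g : X → α} {x y z : X} (h : fiberRel g x y) (h' : fiberRel g y z) :
    fiberRel g x z := by
  refine ⟨h.1.trans h'.1, fun t ht => ?_⟩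
  rcases Set.uIcc_subset_uIcc_union_uIcc (b := y) ht with ht | ht
  · exact h.2 t ht
  · exact h.1 ▸ h'.2 t ht

lemma fiberRel.of_mem_uIcc {g : X → α} {x y z : X} (h : fiberRel g x y)
    (hz : z ∈ Set.uIcc x y) (e : g z = g x) : fiberRel g x z :=
  ⟨e.symm, fun t ht => h.2 t (Set.uIcc_subset_uIcc_left hz ht)⟩

/-- This is why the classes of a word do not cross: `y` lies between `x` and `z`, so its letter is
at least theirs, while `z` lies between `y` and `t`, which gives the reverse inequality. -/
lemma fiberRel.of_lt_of_lt_of_lt {g : X → α} {x y z t : X} (h : fiberRel g x z)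
    (h' : fiberRel g y t) (hxy : x < y) (hyz : y < z) (hzt : z < t) : fiberRel g x y := by
  have hy : y ∈ Set.uIcc x z := Set.mem_uIcc.2 (.inl ⟨hxy.le, hyz.le⟩)
  have hz : z ∈ Set.uIcc y t := Set.mem_uIcc.2 (.inl ⟨hyz.le, hzt.le⟩)
  exact h.of_mem_uIcc hy (le_antisymm (h.1 ▸ h'.2 z hz) (h.2 y hy))

lemma fiberRel_comp_left {φ : α → β} (hφ : StrictMono φ) (g : X → α) (x y : X) :
    fiberRel (φ ∘ g) x y ↔ fiberRel g x y := by
  simp [fiberRel, hφ.injective.eq_iff, hφ.le_iff_le]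

/-- Restricting a word to a subset preserves the relation when the omitted letters are large. -/
lemma fiberRel_comp_right (e : X ↪o Y) (g : Y → α) (x y : X)
    (h : ∀ z ∈ Set.uIcc (e x) (e y), z ∉ Set.range e → g (e x) = g (e y) → g (e x) ≤ g z) :
    fiberRel (g ∘ e) x y ↔ fiberRel g (e x) (e y) := by
  have key (z : X) : e z ∈ Set.uIcc (e x) (e y) ↔ z ∈ Set.uIcc x y := by
    simp [Set.mem_uIcc]
  refine ⟨fun H => ⟨H.1, fun z hz => ?_⟩, fun H => ⟨H.1, fun z hz => H.2 _ ((key z).2 hz)⟩⟩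
  by_cases hr : z ∈ Set.range e
  · obtain ⟨w, rfl⟩ := hr
    exact H.2 w ((key w).1 hz)
  · exact h z hz hr H.1

/-- The number of words on the alphabet `α`, with set of positions `X`, whose associated
equivalence is `r`. -/
noncomputable def wordCount (X : Type*) [LinearOrder X] (r : X → X → Prop) (α : Type*)
    [LinearOrder α] : ℕ :=
  Nat.card {g : X → α // ∀ x y, fiberRel g x y ↔ r x y}

lemma wordCount_congr_alphabet (e : α ≃o β) (r : X → X → Prop) :
    wordCount X r α = wordCount X r β := by
  refine Nat.card_congr ((Equiv.arrowCongr (Equiv.refl X) e.toEquiv).subtypeEquiv fun g => ?_)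
  have : (Equiv.arrowCongr (Equiv.refl X) e.toEquiv) g = e ∘ g := rfl
  rw [this]
  simp only [fiberRel_comp_left e.strictMono]

/-- Only the size of the ordered alphabet matters, which allows sets of small or large letters and
lexicographic products to be used as alphabets. -/
lemma wordCount_eq_fin [Fintype α] {n : ℕ} (h : Fintype.card α = n) (r : X → X → Prop) :
    wordCount X r α = wordCount X r (Fin n) :=
  wordCount_congr_alphabet (Fintype.orderIsoFinOfCardEq α h).symm r

lemma wordCount_congr_positions (e : X ≃o Y) {r : X → X → Prop} {s : Y → Y → Prop}
    (h : ∀ x y, s (e x) (e y) ↔ r x y) : wordCount X r α = wordCount Y s α := by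
  refine Nat.card_congr (((Equiv.arrowCongr e.toEquiv (Equiv.refl α)).symm.subtypeEquiv
    fun g => ?_).symm)
  have : (Equiv.arrowCongr e.toEquiv (Equiv.refl α)).symm g = g ∘ e.toOrderEmbedding := rfl
  rw [this]
  have h2 (x y : X) : fiberRel (g ∘ e.toOrderEmbedding) x y ↔ fiberRel g (e x) (e y) :=
    fiberRel_comp_right _ _ _ _ fun z _ hz => (hz (by simp)).elim
  simp only [h2, ← h]
  exact ⟨fun H x y => H _ _, fun H x y => by simpa using H (e.symm x) (e.symm y)⟩

lemma wordCount_of_isEmpty [IsEmpty X] (r : X → X → Prop) : wordCount X r α = 1 := by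
  rw [wordCount, Nat.card_eq_one_iff_unique]
  exact ⟨inferInstance, ⟨isEmptyElim, fun x => isEmptyElim x⟩⟩

end Words

/-! ### Counting lemmas -/

section Counting

lemma card_subtype_eq_sum {X ι : Type*} [Finite X] {P : X → Prop} (s : Finset ι)
    (Q : ι → X → Prop) (hP : ∀ x, P x ↔ ∃ i ∈ s, Q i x)
    (hQ : ∀ x, ∀ i ∈ s, ∀ j ∈ s, Q i x → Q j x → i = j) :
    Nat.card {x // P x} = ∑ i ∈ s, Nat.card {x // Q i x} := by
  classical
  have := Fintype.ofFinite X
  simp only [Nat.card_eq_fintype_card, Fintype.card_subtype]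
  rw [← Finset.card_biUnion]
  · congr 1
    ext x
    simp [hP]
  · intro i hi j hj hij
    rw [Function.onFun, Finset.disjoint_left]
    intro x hx hx'
    simp only [Finset.mem_filter, Finset.mem_univ, true_and] at hx hx'
    exact hij (hQ x i hi j hj hx hx')

/-- Words on a disjoint union of finite sets are families of words on these sets. -/
lemma prod_card_subtype_eq {ι β : Type*} (s : Finset ι) (C : ι → Finset ℕ) (S : Finset ℕ)
    (hsub : ∀ i ∈ s, C i ⊆ S) (hcov : ∀ x ∈ S, ∃ i ∈ s, x ∈ C i)
    (hdisj : ∀ i ∈ s, ∀ j ∈ s, ∀ x, x ∈ C i → x ∈ C j → i = j)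
    (P : ∀ i, (C i → β) → Prop) :
    ∏ i ∈ s, Nat.card {h : C i → β // P i h} =
      Nat.card {h : S → β // ∀ i, ∀ hi : i ∈ s, P i (fun x => h ⟨x.1, hsub i hi x.2⟩)} := by
  classical
  rw [← Finset.prod_coe_sort, ← Nat.card_pi,
    ← Nat.card_congr (Equiv.subtypePiEquivPi (β := fun i : s => (C i.1 → β))
      (p := fun i h => P i.1 h))]
  choose k hks hk using hcov
  let F : (S → β) ≃ (∀ i : s, C i.1 → β) :=
    { toFun := fun h i x => h ⟨x.1, hsub i.1 i.2 x.2⟩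
      invFun := fun f x => f ⟨k x.1 x.2, hks x.1 x.2⟩ ⟨x.1, hk x.1 x.2⟩
      left_inv := fun h => rfl
      right_inv := fun f => by
        funext i x
        have e : (⟨k x.1 (hsub i.1 i.2 x.2), hks _ _⟩ : s) = i :=
          Subtype.ext (hdisj _ (hks _ _) _ i.2 x.1 (hk _ _) x.2)
        have gen (j : s) (hj : j = i) (hx : x.1 ∈ C j.1) : f j ⟨x.1, hx⟩ = f i x := by
          subst hj; rfl
        exact gen _ e _ }
  refine (Nat.card_congr (F.subtypeEquiv fun h => ?_)).symm
  simp only [Subtype.forall]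
  rfl

end Counting

/-! ### Polynomiality -/

section Polynomiality

/-- Order-invariant conditions on words are counted by polynomials in the number of letters. -/
lemma exists_polynomial_eval_eq_card {K X : Type*} [Field K] [CharZero K] [Finite X]
    (P : ∀ n : ℕ, (X → Fin n) → Prop)
    (hP : ∀ k n (φ : Fin k ↪o Fin n) (g : X → Fin k), P n (φ ∘ g) ↔ P k g) :
    ∃ p : Polynomial K, ∀ n : ℕ, p.eval (n : K) = (Nat.card {g : X → Fin n // P n g} : K) := by
  classical
  have := Fintype.ofFinite X
  -- Words are sorted by their set `A` of letters; by order invariance, those with letter set `A`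
  -- are counted by `a A.card`.
  let a (k : ℕ) : ℕ := Nat.card {g : X → Fin k // P k g ∧ Function.Surjective g}
  have ha (k : ℕ) (hk : Fintype.card X < k) : a k = 0 := by
    rw [Nat.card_eq_zero]
    left
    constructor
    rintro ⟨g, -, hg⟩
    have := Fintype.card_le_of_surjective g hg
    simp at this
    omega
  have step (n : ℕ) : Nat.card {g : X → Fin n // P n g} =
      ∑ A : Finset (Fin n), a A.card := by
    rw [card_subtype_eq_sum Finset.univ
      (fun (A : Finset (Fin n)) (g : X → Fin n) => P n g ∧ Set.range g = A)]
    · refine Finset.sum_congr rfl fun A _ => ?_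
      symm
      let e := A.orderEmbOfFin rfl
      have he : Set.range e = A := Finset.range_orderEmbOfFin A rfl
      refine Nat.card_congr (Equiv.ofBijective
        (fun g => ⟨e ∘ g.1, (hP _ _ e g.1).2 g.2.1, ?_⟩) ⟨?_, ?_⟩)
      · rw [Set.range_comp, g.2.2.range_eq, Set.image_univ, he]
      · intro g g' h
        apply Subtype.ext
        have := congrArg Subtype.val h
        exact funext fun x => e.injective (congrFun this x)
      · rintro ⟨g, hg, hgA⟩
        have : ∀ x, ∃ i, e i = g x := fun x => by
          have : g x ∈ Set.range e := by rw [he, ← hgA]; exact ⟨x, rfl⟩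
          exact this
        choose g' hg' using this
        have hcomp : e ∘ g' = g := funext hg'
        refine ⟨⟨g', (hP _ _ e g').1 (hcomp ▸ hg), fun i => ?_⟩, Subtype.ext hcomp⟩
        have : e i ∈ Set.range g := by rw [hgA, ← he]; exact ⟨i, rfl⟩
        obtain ⟨x, hx⟩ := this
        exact ⟨x, e.injective ((hg' x).trans hx)⟩
    · intro g
      refine ⟨fun h => ⟨(Set.range g).toFinset, Finset.mem_univ _, h, by simp⟩, ?_⟩
      rintro ⟨A, -, h, -⟩
      exact h
    · intro g A _ B _ hA hB
      exact_mod_cast hA.2.symm.trans hB.2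
  -- The polynomial is `∑ a k * (X choose k)`, the binomial being a falling factorial divided by
  -- `k!`; this division needs characteristic zero. The degree bound is uniform in `n` because `a k
  -- = 0` beyond `Fintype.card X`.
  refine ⟨∑ k ∈ Finset.range (Fintype.card X + 1),
    Polynomial.C ((a k : K) / (k.factorial : K)) * descPochhammer K k, fun n => ?_⟩
  have h1 : ∑ A : Finset (Fin n), a A.card =
      ∑ k ∈ Finset.range (n + 1), n.choose k * a k := by
    have := Finset.sum_powerset_apply_card a (x := (Finset.univ : Finset (Fin n)))
    simpa using this
  have h2 : ∑ k ∈ Finset.range (n + 1), n.choose k * a k =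
      ∑ k ∈ Finset.range (Fintype.card X + 1), n.choose k * a k := by
    rcases le_total (n + 1) (Fintype.card X + 1) with h | h
    · refine Finset.sum_subset (Finset.range_mono h) fun k _ hk => ?_
      rw [Nat.choose_eq_zero_of_lt (by simpa using hk), zero_mul]
    · refine (Finset.sum_subset (Finset.range_mono h) fun k _ hk => ?_).symm
      rw [ha k (by simpa using hk), mul_zero]
  rw [step, h1, h2, Polynomial.eval_finsetSum, Nat.cast_sum]
  refine Finset.sum_congr rfl fun k _ => ?_
  rw [Polynomial.eval_mul, Polynomial.eval_C, descPochhammer_eval_eq_descFactorial,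
    Nat.descFactorial_eq_factorial_mul_choose]
  have : (k.factorial : K) ≠ 0 := Nat.cast_ne_zero.2 k.factorial_ne_zero
  push_cast
  field_simp

lemma exists_polynomial_eval_eq_wordCount (K : Type*) {X : Type*} [Field K] [CharZero K]
    [Finite X] [LinearOrder X] (r : X → X → Prop) :
    ∃ p : Polynomial K, ∀ n : ℕ, p.eval (n : K) = (wordCount X r (Fin n) : K) :=
  exists_polynomial_eval_eq_card (fun n g => ∀ x y, fiberRel g x y ↔ r x y)
    fun k n φ g => by simp only [fiberRel_comp_left φ.strictMono]

end Polynomiality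

/-! ### Evaluations of polynomials -/

section Evaluation

variable {K : Type*} [Field K]

/-- The coefficient ring is a general domain because the result is needed over both `K` and
`Polynomial K`. -/
lemma eq_of_eval_natCast [CharZero K] {R : Type*} [CommRing R] [IsDomain R] [Algebra K R]
    {p q : Polynomial R} (h : ∀ n : ℕ, p.eval (n : R) = q.eval (n : R)) : p = q := by
  have : CharZero R := charZero_of_injective_algebraMap (algebraMap K R).injective
  refine Polynomial.eq_of_infinite_eval_eq p q (Set.Infinite.mono ?_
    (Set.infinite_range_of_injective (Nat.cast_injective (R := R))))
  rintro _ ⟨n, rfl⟩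
  exact h n

variable (K) in
/-- Evaluation of an element of `K[X] ⊗ K[X]` at a pair of scalars. -/
noncomputable def evalPair (a b : K) : Polynomial K ⊗[K] Polynomial K →ₐ[K] K :=
  Algebra.TensorProduct.lift (Polynomial.aeval a) (Polynomial.aeval b) fun _ _ => .all _ _

@[simp] lemma evalPair_tmul (a b : K) (p q : Polynomial K) :
    evalPair K a b (p ⊗ₜ q) = p.eval a * q.eval b := by
  simp [evalPair, Polynomial.aeval_def]

lemma evalPair_polyEquivTensor (a b : K) (P : Polynomial (Polynomial K)) :
    evalPair K a b (polyEquivTensor K (Polynomial K) P) =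
      (P.eval (Polynomial.C b)).eval a := by
  induction P using Polynomial.induction_on' with
  | add p q hp hq => rw [map_add, map_add, hp, hq, Polynomial.eval_add, Polynomial.eval_add]
  | monomial n p =>
    rw [← Polynomial.C_mul_X_pow_eq_monomial]
    simp [polyEquivTensor_apply, Polynomial.eval₂_mul, Polynomial.eval_mul]

/-- `K[X] ⊗ K[X]` is a polynomial ring over `K[X]`, so its elements are separated by natural-number
evaluations, taken in one variable and then in the other. -/
lemma tensor_ext_of_evalPair [CharZero K] {u v : Polynomial K ⊗[K] Polynomial K}
    (h : ∀ m n : ℕ, evalPair K m n u = evalPair K m n v) : u = v := by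
  obtain ⟨P, rfl⟩ := (polyEquivTensor K (Polynomial K)).surjective u
  obtain ⟨Q, rfl⟩ := (polyEquivTensor K (Polynomial K)).surjective v
  congr 1
  refine eq_of_eval_natCast (K := K) fun n => eq_of_eval_natCast (K := K) fun m => ?_
  have := h m n
  rwa [evalPair_polyEquivTensor, evalPair_polyEquivTensor, map_natCast] at this

lemma evalPair_polyΔ (a b : K) (p : Polynomial K) :
    evalPair K a b (polyΔ K p) = p.eval (a + b) := by
  have : (evalPair K a b).comp (polyΔ K) = Polynomial.aeval (a + b) := by
    ext; simp [polyΔ]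
  simpa [Polynomial.aeval_def] using DFunLike.congr_fun this p

lemma evalPair_polyδ (a b : K) (p : Polynomial K) :
    evalPair K a b (polyδ K p) = p.eval (a * b) := by
  have : (evalPair K a b).comp (polyδ K) = Polynomial.aeval (a * b) := by
    ext; simp [polyδ]
  simpa [Polynomial.aeval_def] using DFunLike.congr_fun this p

/-- The character `x ↦ φ(x)(a)`. -/
noncomputable def evalAt (φ : Alg K →ₐ[K] Polynomial K) (a : K) : Alg K →ₐ[K] K :=
  (Polynomial.aeval a).comp φ

lemma evalAt_apply (φ : Alg K →ₐ[K] Polynomial K) (a : K) (x : Alg K) :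
    evalAt φ a x = (φ x).eval a := by
  simp [evalAt]

/-- The product of two characters, on the tensor square. -/
noncomputable def tensorChar (f g : Alg K →ₐ[K] K) : Alg K ⊗[K] Alg K →ₐ[K] K :=
  Algebra.TensorProduct.lift f g fun _ _ => .all _ _

@[simp] lemma tensorChar_tmul (f g : Alg K →ₐ[K] K) (x y : Alg K) :
    tensorChar f g (x ⊗ₜ y) = f x * g y := by
  simp [tensorChar]

lemma evalPair_comp_map (φ : Alg K →ₐ[K] Polynomial K) (a b : K) :
    (evalPair K a b).comp (Algebra.TensorProduct.map φ φ) =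
      tensorChar (evalAt φ a) (evalAt φ b) := by
  ext <;> simp [evalAt_apply]

end Evaluation

/-! ### Uniqueness -/

section Uniqueness

variable {K : Type*} [Field K]

lemma IsDoubleBialgHom.evalAt_add {φ : Alg K →ₐ[K] Polynomial K} (h : IsDoubleBialgHom φ)
    (a b : K) : evalAt φ (a + b) = (tensorChar (evalAt φ a) (evalAt φ b)).comp (coprodΔ K) := by
  rw [← evalPair_comp_map, AlgHom.comp_assoc, ← h.map_Δ]
  refine AlgHom.ext fun x => ?_
  simp [evalAt_apply, evalPair_polyΔ]

lemma IsDoubleBialgHom.evalAt_one {φ : Alg K →ₐ[K] Polynomial K} (h : IsDoubleBialgHom φ) :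
    evalAt φ 1 = counitδ K := h.map_counitδ

lemma IsDoubleBialgHom.evalAt_zero {φ : Alg K →ₐ[K] Polynomial K} (h : IsDoubleBialgHom φ) :
    evalAt φ 0 = counitΔ K := h.map_counitΔ

/-- Starting from `0`, repeated convolution with the character at `1` reaches every natural number;
both characters are prescribed by the counits. -/
lemma IsDoubleBialgHom.eq [CharZero K] {φ ψ : Alg K →ₐ[K] Polynomial K}
    (hφ : IsDoubleBialgHom φ) (hψ : IsDoubleBialgHom ψ) : φ = ψ := by
  have key (n : ℕ) : evalAt φ (n : K) = evalAt ψ (n : K) := by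
    induction n with
    | zero => rw [Nat.cast_zero, hφ.evalAt_zero, hψ.evalAt_zero]
    | succ n ih =>
      rw [Nat.cast_succ, hφ.evalAt_add, hψ.evalAt_add, ih, hφ.evalAt_one, hψ.evalAt_one]
  refine AlgHom.ext fun x => eq_of_eval_natCast (K := K) fun n => ?_
  rw [← evalAt_apply, ← evalAt_apply, key]

end Uniqueness

/-! ### Words and families of blocks -/

section Families

/-- `x` and `y` belong to the same block of `B`. -/
def blockRel (B : Finset (Finset ℕ)) (x y : ℕ) : Prop := ∃ b ∈ B, x ∈ b ∧ y ∈ b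

/-- The number of words with set of positions `S` whose associated equivalence is that of the
family of blocks `B`. -/
noncomputable def famCount (S : Finset ℕ) (B : Finset (Finset ℕ)) (α : Type*) [LinearOrder α] :
    ℕ :=
  wordCount S (fun x y => blockRel B x y) α

lemma mem_sup_iff {B : Finset (Finset ℕ)} {x : ℕ} : x ∈ B.sup id ↔ ∃ b ∈ B, x ∈ b := by
  simp [Finset.mem_sup]

lemma IsNCFamily.eq_of_mem {B : Finset (Finset ℕ)} (h : IsNCFamily B) {b b' : Finset ℕ}
    (hb : b ∈ B) (hb' : b' ∈ B) {x : ℕ} (hx : x ∈ b) (hx' : x ∈ b') : b = b' := by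
  by_contra hne
  exact Finset.disjoint_left.1 (h.pairwiseDisjoint hb hb' hne) hx hx'

lemma IsNCFamily.nonempty {B : Finset (Finset ℕ)} (h : IsNCFamily B) {b : Finset ℕ}
    (hb : b ∈ B) : b.Nonempty :=
  Finset.nonempty_iff_ne_empty.2 fun e => h.empty_notMem (e ▸ hb)

lemma IsNCFamily.mono {B B' : Finset (Finset ℕ)} (h : IsNCFamily B) (hB : B' ⊆ B) :
    IsNCFamily B' where
  empty_notMem := fun h0 => h.empty_notMem (hB h0)
  pairwiseDisjoint := h.pairwiseDisjoint.subset (by exact_mod_cast hB)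
  noncrossing := fun b hb b' hb' => h.noncrossing b (hB hb) b' (hB hb')

lemma NCP.isNCFamily (π : NCP) : IsNCFamily π.blocks where
  empty_notMem := π.part.bot_notMem
  pairwiseDisjoint := π.part.disjoint
  noncrossing := π.noncrossing

lemma NCP.sup_blocks (π : NCP) : π.blocks.sup id = Finset.Icc 1 π.size := π.part.sup_parts

/-- Standardization relabels positions along the increasing bijection `rank`, and the equivalence of
a word depends only on the order of its positions. -/
lemma IsNCFamily.famCount_std {B : Finset (Finset ℕ)} (h : IsNCFamily B) (hB : B.Nonempty)
    (α : Type*) [LinearOrder α] :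
    famCount (Finset.Icc 1 (h.std hB).size) (h.std hB).blocks α = famCount (B.sup id) B α := by
  have hmem (x : (B.sup id : Finset ℕ)) : rank (B.sup id) x ∈ Finset.Icc 1 (h.std hB).size := by
    change _ ∈ Finset.Icc 1 (B.sup id).card
    rw [← image_rank]
    exact Finset.mem_image_of_mem _ x.2
  let e : ↥(B.sup id) → Finset.Icc 1 (h.std hB).size :=
    fun x => ⟨rank (B.sup id) x, hmem x⟩
  have he : StrictMono e := fun x y hxy => rank_lt_rank y.2 hxy
  have hsurj : Function.Surjective e := by
    rintro ⟨k, hk⟩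
    change k ∈ Finset.Icc 1 (B.sup id).card at hk
    rw [← image_rank] at hk
    obtain ⟨x, hx, rfl⟩ := Finset.mem_image.1 hk
    exact ⟨⟨x, hx⟩, rfl⟩
  refine (wordCount_congr_positions (he.orderIsoOfSurjective e hsurj) fun x y => ?_).symm
  change (∃ c ∈ B.image fun b => b.image (rank (B.sup id)), rank (B.sup id) x ∈ c ∧
    rank (B.sup id) y ∈ c) ↔ _
  have key (b : Finset ℕ) (hb : b ∈ B) (z : ℕ) (hz : z ∈ B.sup id) :
      rank (B.sup id) z ∈ b.image (rank (B.sup id)) ↔ z ∈ b := by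
    refine ⟨fun hr => ?_, Finset.mem_image_of_mem _⟩
    obtain ⟨w, hw, e⟩ := Finset.mem_image.1 hr
    rwa [← rank_injOn _ (subset_sup hb hw) hz e]
  constructor
  · rintro ⟨c, hc, hx, hy⟩
    obtain ⟨b, hb, rfl⟩ := Finset.mem_image.1 hc
    exact ⟨b, hb, (key b hb _ x.2).1 hx, (key b hb _ y.2).1 hy⟩
  · rintro ⟨b, hb, hx, hy⟩
    exact ⟨_, Finset.mem_image_of_mem _ hb, Finset.mem_image_of_mem _ hx,
      Finset.mem_image_of_mem _ hy⟩

/-- A character that counts words on the generators counts words on all restrictions. -/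
lemma IsNCFamily.map_elt {K : Type*} [Field K] {χ : Alg K →ₐ[K] K} {n : ℕ}
    (hχ : ∀ π : NCP,
      χ (MvPolynomial.X π) = (famCount (Finset.Icc 1 π.size) π.blocks (Fin n) : K))
    {B : Finset (Finset ℕ)} (h : IsNCFamily B) :
    χ (elt K B) = (famCount (B.sup id) B (Fin n) : K) := by
  unfold elt
  by_cases hB : B.Nonempty
  · rw [dif_pos ⟨h, hB⟩, hχ, h.famCount_std hB]
  -- The convention `π_{∣∅} = 1` matches the single empty word.
  · rw [dif_neg fun H => hB H.2, map_one]
    obtain rfl := Finset.not_nonempty_iff_eq_empty.1 hB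
    have : IsEmpty (((∅ : Finset (Finset ℕ)).sup id : Finset ℕ)) :=
      ⟨fun x => by simpa using x.2⟩
    rw [famCount, wordCount_of_isEmpty, Nat.cast_one]

end Families

/-! ### Valid colorations as words -/

section Colorations

variable (π : NCP)

lemma NCP.exists_block {x : ℕ} (hx : x ∈ Finset.Icc 1 π.size) : ∃ b : π.blocks, x ∈ b.1 := by
  rw [← π.sup_blocks, mem_sup_iff] at hx
  obtain ⟨b, hb, hxb⟩ := hx
  exact ⟨⟨b, hb⟩, hxb⟩

/-- The block containing an element. -/
noncomputable def NCP.blockOf (x : Finset.Icc 1 π.size) : π.blocks :=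
  (π.exists_block x.2).choose

lemma NCP.mem_blockOf (x : Finset.Icc 1 π.size) : x.1 ∈ (π.blockOf x).1 :=
  (π.exists_block x.2).choose_spec

lemma NCP.mem_Icc_of_mem (b : π.blocks) {x : ℕ} (hx : x ∈ b.1) : x ∈ Finset.Icc 1 π.size := by
  rw [← π.sup_blocks]
  exact subset_sup b.2 hx

lemma NCP.blockOf_eq {b : π.blocks} {x : Finset.Icc 1 π.size} (hx : x.1 ∈ b.1) :
    π.blockOf x = b :=
  Subtype.ext (π.isNCFamily.eq_of_mem (π.blockOf x).2 b.2 (π.mem_blockOf x) hx)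

lemma NCP.blockRel_iff (x y : Finset.Icc 1 π.size) :
    blockRel π.blocks x y ↔ π.blockOf x = π.blockOf y := by
  constructor
  · rintro ⟨b, hb, hx, hy⟩
    rw [π.blockOf_eq (b := ⟨b, hb⟩) hx, π.blockOf_eq (b := ⟨b, hb⟩) hy]
  · intro h
    exact ⟨_, (π.blockOf x).2, π.mem_blockOf x, h ▸ π.mem_blockOf y⟩

lemma NCP.bmin_mem (b : π.blocks) : π.bmin b ∈ b.1 := Finset.min'_mem _ _

lemma NCP.bmax_mem (b : π.blocks) : π.bmax b ∈ b.1 := Finset.max'_mem _ _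

lemma NCP.bmin_le {b : π.blocks} {x : ℕ} (hx : x ∈ b.1) : π.bmin b ≤ x := Finset.min'_le _ _ hx

lemma NCP.le_bmax {b : π.blocks} {x : ℕ} (hx : x ∈ b.1) : x ≤ π.bmax b := Finset.le_max' _ _ hx

lemma NCP.ne_of_mem_of_mem {b b' : π.blocks} (hne : b ≠ b') {x y : ℕ} (hx : x ∈ b.1)
    (hy : y ∈ b'.1) : x ≠ y := fun e =>
  hne (Subtype.ext (π.isNCFamily.eq_of_mem b.2 b'.2 hx (e ▸ hy)))

/-- If `b'` meets the span of `b` and also leaves it, a point of `b'` outside, a point inside and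
two points of `b` form a crossing. -/
lemma NCP.nestLE_of_between {b b' : π.blocks} (hne : b ≠ b') {x y z : ℕ} (hx : x ∈ b.1)
    (hz : z ∈ b.1) (hy : y ∈ b'.1) (hxy : x ≤ y) (hyz : y ≤ z) : π.nestLE b b' := by
  have hxy' := lt_of_le_of_ne hxy (π.ne_of_mem_of_mem hne hx hy)
  have hyz' := lt_of_le_of_ne hyz (π.ne_of_mem_of_mem hne hz hy).symm
  have hne1 : b.1 ≠ b'.1 := fun e => hne (Subtype.ext e)
  intro t ht
  rw [Finset.mem_Icc]
  constructor
  · by_contra hlt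
    exact π.noncrossing b'.1 b'.2 b.1 b.2 hne1.symm t ht y hy _ (π.bmin_mem b) z hz
      ⟨not_le.1 hlt, (π.bmin_le hx).trans_lt hxy', hyz'⟩
  · by_contra hlt
    exact π.noncrossing b.1 b.2 b'.1 b'.2 hne1 x hx _ (π.bmax_mem b) y hy t ht
      ⟨hxy', hyz'.trans_le (π.le_bmax hz), not_le.1 hlt⟩

lemma NCP.nestLE_or_nestLE_or_lt {b b' : π.blocks} (hne : b ≠ b') {x y : ℕ} (hx : x ∈ b.1)
    (hy : y ∈ b'.1) (hxy : x < y) :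
    π.nestLE b b' ∨ π.nestLE b' b ∨ π.bmax b < π.bmin b' := by
  rcases le_or_gt y (π.bmax b) with h | h
  · exact .inl (π.nestLE_of_between hne hx (π.bmax_mem b) hy hxy.le h)
  rcases le_or_gt (π.bmin b') (π.bmax b) with h' | h'
  · exact .inr (.inl (π.nestLE_of_between hne.symm (π.bmin_mem b') hy (π.bmax_mem b) h' h.le))
  · exact .inr (.inr h')

variable {π} {n : ℕ}

/-- Distinct blocks are nested, hence of different colors, or side by side, where equal colors are
separated by a smaller one. Conversely, anything between two points of one block lies in that block
or in a nested one, of larger color. -/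
lemma IsValidColoration.fiberRel_iff {f : π.blocks → Fin n} (hf : IsValidColoration π f)
    (x y : Finset.Icc 1 π.size) :
    fiberRel (fun x => f (π.blockOf x)) x y ↔ blockRel π.blocks x y := by
  wlog hxy : x ≤ y generalizing x y
  · have := this y x (le_of_not_ge hxy)
    refine ⟨fun h => ?_, fun h => ?_⟩
    · obtain ⟨b, hb, h1, h2⟩ := this.1 h.symm
      exact ⟨b, hb, h2, h1⟩
    · obtain ⟨b, hb, h1, h2⟩ := h
      exact (this.2 ⟨b, hb, h2, h1⟩).symm
  rw [π.blockRel_iff]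
  constructor
  · intro h
    by_contra hne
    have hlt : x.1 < y.1 :=
      lt_of_le_of_ne hxy (π.ne_of_mem_of_mem hne (π.mem_blockOf x) (π.mem_blockOf y))
    rcases π.nestLE_or_nestLE_or_lt hne (π.mem_blockOf x) (π.mem_blockOf y) hlt with h' | h' | h'
    · exact (hf.increasing _ _ h' hne).ne h.1
    · exact (hf.increasing _ _ h' (Ne.symm hne)).ne h.1.symm
    · obtain ⟨b, ⟨z, hz⟩, hb⟩ := hf.bCondition _ _ h.1 h'
      rw [Finset.mem_inter, Finset.mem_Ioo] at hz
      have h1 := π.le_bmax (π.mem_blockOf x)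
      have h2 := π.bmin_le (π.mem_blockOf y)
      have := h.2 ⟨z, π.mem_Icc_of_mem b hz.2⟩
        (Set.mem_uIcc.2 (.inl ⟨h1.trans hz.1.1.le, hz.1.2.le.trans h2⟩))
      have hzb : π.blockOf ⟨z, π.mem_Icc_of_mem b hz.2⟩ = b := π.blockOf_eq hz.2
      simp only [hzb] at this
      exact absurd hb (not_lt.2 this)
  · intro h
    refine ⟨congrArg f h, fun z hz => ?_⟩
    by_cases hzx : π.blockOf x = π.blockOf z
    · exact (congrArg f hzx).le
    · rw [Set.uIcc_of_le hxy] at hz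
      exact (hf.increasing _ _ (π.nestLE_of_between hzx (π.mem_blockOf x)
        (h ▸ π.mem_blockOf y) (π.mem_blockOf z) hz.1 hz.2) hzx).le

lemma isValidColoration_of_fiberRel {f : π.blocks → Fin n}
    (h : ∀ x y : Finset.Icc 1 π.size,
      fiberRel (fun x => f (π.blockOf x)) x y ↔ blockRel π.blocks x y) :
    IsValidColoration π f where
  increasing := by
    intro b b' hn hne
    let x : Finset.Icc 1 π.size := ⟨_, π.mem_Icc_of_mem b (π.bmin_mem b)⟩
    let z : Finset.Icc 1 π.size := ⟨_, π.mem_Icc_of_mem b (π.bmax_mem b)⟩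
    let y : Finset.Icc 1 π.size := ⟨_, π.mem_Icc_of_mem b' (π.bmin_mem b')⟩
    have hx : π.blockOf x = b := π.blockOf_eq (π.bmin_mem b)
    have hz : π.blockOf z = b := π.blockOf_eq (π.bmax_mem b)
    have hy : π.blockOf y = b' := π.blockOf_eq (π.bmin_mem b')
    have hxz : fiberRel (fun x => f (π.blockOf x)) x z :=
      (h x z).2 ((π.blockRel_iff x z).2 (hx.trans hz.symm))
    have hyI := Finset.mem_Icc.1 (hn (π.bmin_mem b'))
    have hymem : y ∈ Set.uIcc x z := Set.mem_uIcc.2 (.inl ⟨hyI.1, hyI.2⟩)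
    have hle := hxz.2 y hymem
    -- With equal colors, the intermediate position `y` would be related to `x`, so `b = b'`.
    refine lt_of_le_of_ne (by simpa only [hx, hy] using hle) fun e => hne ?_
    have := hxz.of_mem_uIcc hymem (by simp only [hx, hy, e])
    rw [h, π.blockRel_iff, hx, hy] at this
    exact this
  bCondition := by
    intro b b' e hlt
    -- If no smaller color separates `b` from `b'`, then `max b` and `min b'` are related, so the
    -- blocks coincide, contradicting `max b < min b'`.
    by_contra hcon
    push Not at hcon
    let x : Finset.Icc 1 π.size := ⟨_, π.mem_Icc_of_mem b (π.bmax_mem b)⟩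
    let y : Finset.Icc 1 π.size := ⟨_, π.mem_Icc_of_mem b' (π.bmin_mem b')⟩
    have hx : π.blockOf x = b := π.blockOf_eq (π.bmax_mem b)
    have hy : π.blockOf y = b' := π.blockOf_eq (π.bmin_mem b')
    have hxy : fiberRel (fun x => f (π.blockOf x)) x y := by
      refine ⟨by simp only [hx, hy, e], fun z hz => ?_⟩
      rw [Set.uIcc_of_le (show x ≤ y from hlt.le)] at hz
      rcases hz.1.eq_or_lt with h1 | h1
      · rw [h1]
      rcases hz.2.eq_or_lt with h2 | h2
      · rw [h2]; simp only [hx, hy, e, le_refl]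
      · simp only [hx]
        exact hcon (π.blockOf z)
          ⟨z.1, Finset.mem_inter.2 ⟨Finset.mem_Ioo.2 ⟨h1, h2⟩, π.mem_blockOf z⟩⟩
    rw [h, π.blockRel_iff, hx, hy] at hxy
    subst hxy
    exact absurd hlt (not_lt.2 (π.bmin_le (π.bmax_mem b)))

variable (π n)

/-- A word coding `π` is constant on blocks, so it comes from a unique coloration, read off at the
block minima. -/
lemma card_isValidColoration :
    Nat.card {f : π.blocks → Fin n // IsValidColoration π f} =
      famCount (Finset.Icc 1 π.size) π.blocks (Fin n) := by
  refine Nat.card_congr (Equiv.ofBijective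
    (fun f => ⟨fun x => f.1 (π.blockOf x), f.2.fiberRel_iff⟩) ⟨?_, ?_⟩)
  · intro f f' h
    refine Subtype.ext (funext fun b => ?_)
    have := congrFun (congrArg Subtype.val h) ⟨_, π.mem_Icc_of_mem b (π.bmin_mem b)⟩
    simpa only [π.blockOf_eq (b := b) (x := ⟨_, π.mem_Icc_of_mem b (π.bmin_mem b)⟩)
      (π.bmin_mem b)] using this
  · rintro ⟨g, hg⟩
    let f : π.blocks → Fin n := fun b => g ⟨_, π.mem_Icc_of_mem b (π.bmin_mem b)⟩
    have hfg : (fun x => f (π.blockOf x)) = g := by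
      funext x
      exact ((hg _ _).2 ⟨_, (π.blockOf x).2, π.bmin_mem _, π.mem_blockOf x⟩).1
    exact ⟨⟨f, isValidColoration_of_fiberRel (by rw [hfg]; exact hg)⟩, Subtype.ext hfg⟩

end Colorations

/-! ### Restrictions of words -/

section Restriction

variable {S : Finset ℕ} {γ : Type*} [LinearOrder γ]

/-- The restriction of the word `g` to the positions in `C` has associated equivalence `B`. -/
def Codes (g : S → γ) (C : Finset ℕ) (B : Finset (Finset ℕ)) : Prop :=
  ∀ x y : S, x.1 ∈ C → y.1 ∈ C →
    ((g x = g y ∧ ∀ z : S, z.1 ∈ C → z ∈ Set.uIcc x y → g x ≤ g z) ↔ blockRel B x y)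

lemma codes_iff {g : S → γ} {C : Finset ℕ} (h : C ⊆ S) {B : Finset (Finset ℕ)} :
    Codes g C B ↔ ∀ x y : C, fiberRel (fun z : C => g ⟨z, h z.2⟩) x y ↔ blockRel B x y := by
  constructor
  · intro H x y
    rw [← H ⟨x, h x.2⟩ ⟨y, h y.2⟩ x.2 y.2]
    exact and_congr_right fun _ => ⟨fun H z hz hz' => H ⟨z, hz⟩ hz', fun H z hz => H _ z.2 hz⟩
  · intro H x y hx hy
    rw [← H ⟨x, hx⟩ ⟨y, hy⟩]
    exact and_congr_right fun _ => ⟨fun H z hz => H _ z.2 hz, fun H z hz hz' => H ⟨z, hz⟩ hz'⟩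

/-- Viewing the letters of a sub-alphabet in `γ` allows words on small and on large letters to be
glued. -/
lemma wordCount_subtype {X : Type*} [LinearOrder X] (r : X → X → Prop) (p : γ → Prop) :
    wordCount X r {c // p c} = Nat.card {g : X → {c // p c} //
      ∀ x y, fiberRel (fun z => (g z).1) x y ↔ r x y} := by
  refine Nat.card_congr (Equiv.subtypeEquivRight fun g => ?_)
  have (x y : X) : fiberRel (fun z => (g z).1) x y ↔ fiberRel g x y :=
    fiberRel_comp_left (Subtype.strictMono_coe p) g x y
  simp only [this]

/-- Words with a prescribed set `T` of positions of large letters are pairs of words. -/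
lemma card_glue {A : Type*} (hi : A → Prop) {U T : Finset ℕ} (hU : U ⊆ S) (hT : T ⊆ S)
    (hUT : ∀ x ∈ S, x ∈ U ↔ x ∉ T) (P : (U → A) → Prop) (Q : (T → A) → Prop) :
    Nat.card {g : S → A // (∀ x, hi (g x) ↔ x.1 ∈ T) ∧ P (fun x => g ⟨x, hU x.2⟩) ∧
        Q (fun x => g ⟨x, hT x.2⟩)} =
      Nat.card {g : U → {c // ¬ hi c} // P fun x => (g x).1} *
        Nat.card {g : T → {c // hi c} // Q fun x => (g x).1} := by
  classical
  rw [← Nat.card_prod]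
  let glue (g : U → {c // ¬ hi c}) (g' : T → {c // hi c}) (x : S) : A :=
    if h : x.1 ∈ T then (g' ⟨x, h⟩).1 else (g ⟨x, (hUT x x.2).2 h⟩).1
  have hglueU (g g') (x : U) : glue g g' ⟨x, hU x.2⟩ = (g x).1 :=
    dif_neg ((hUT x (hU x.2)).1 x.2)
  have hglueT (g g') (x : T) : glue g g' ⟨x, hT x.2⟩ = (g' x).1 := dif_pos x.2
  refine Nat.card_congr
    { toFun := fun g =>
        (⟨fun x => ⟨g.1 ⟨x, hU x.2⟩, fun h => (hUT x (hU x.2)).1 x.2 ((g.2.1 _).1 h)⟩, g.2.2.1⟩,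
          ⟨fun x => ⟨g.1 ⟨x, hT x.2⟩, (g.2.1 _).2 x.2⟩, g.2.2.2⟩)
      invFun := fun g => ⟨glue g.1.1 g.2.1, fun x => ?_, ?_, ?_⟩
      left_inv := fun g => Subtype.ext (funext fun x => ?_)
      right_inv := fun g => ?_ }
  · by_cases h : x.1 ∈ T
    · simp only [glue, h, dif_pos, iff_true]
      exact (g.2.1 _).2
    · simp only [glue, h, dif_neg, iff_false, not_false_eq_true]
      exact (g.1.1 _).2
  · simp only [hglueU]
    exact g.1.2
  · simp only [hglueT]
    exact g.2.2
  · by_cases h : x.1 ∈ T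
    · exact dif_pos h
    · exact dif_neg h
  · refine Prod.ext (Subtype.ext (funext fun x => Subtype.ext ?_))
      (Subtype.ext (funext fun x => Subtype.ext ?_))
    · exact hglueU _ _ x
    · exact hglueT _ _ x

end Restriction

/-! ### Connected components -/

section Components

variable {T C C' : Finset ℕ} {x y : ℕ}

lemma mem_components : C ∈ components T ↔
    ∃ x ∈ T, ∀ y, y ∈ C ↔ y ∈ T ∧ Finset.uIcc x y ⊆ T := by
  classical
  simp only [components, Finset.mem_image]
  refine exists_congr fun x => and_congr_right fun _ => ?_
  rw [Finset.ext_iff]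
  refine forall_congr' fun y => ?_
  simp only [Finset.mem_filter]
  exact ⟨fun h => h.symm, fun h => h.symm⟩

lemma subset_of_mem_components (hC : C ∈ components T) : C ⊆ T := by
  obtain ⟨x, -, h⟩ := mem_components.1 hC
  exact fun y hy => ((h y).1 hy).1

lemma mem_component_of_uIcc_subset (hC : C ∈ components T) (hx : x ∈ C)
    (h : Finset.uIcc x y ⊆ T) : y ∈ C := by
  obtain ⟨a, -, ha⟩ := mem_components.1 hC
  refine (ha y).2 ⟨h Finset.right_mem_uIcc, fun t ht => ?_⟩
  rcases Finset.mem_union.1 (Finset.uIcc_subset_uIcc_union_uIcc (b := x) ht) with ht | ht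
  · exact ((ha x).1 hx).2 ht
  · exact h ht

lemma uIcc_subset_of_mem_component (hC : C ∈ components T) (hx : x ∈ C) (hy : y ∈ C) :
    Finset.uIcc x y ⊆ T := by
  obtain ⟨a, -, ha⟩ := mem_components.1 hC
  intro t ht
  rcases Finset.mem_union.1 (Finset.uIcc_subset_uIcc_union_uIcc (b := a) ht) with ht | ht
  · exact ((ha x).1 hx).2 (Finset.uIcc_comm a x ▸ ht)
  · exact ((ha y).1 hy).2 ht

lemma uIcc_subset_component (hC : C ∈ components T) (hx : x ∈ C) (hy : y ∈ C) :
    Finset.uIcc x y ⊆ C := fun _ ht =>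
  mem_component_of_uIcc_subset hC hx
    ((Finset.uIcc_subset_uIcc_left ht).trans (uIcc_subset_of_mem_component hC hx hy))

lemma exists_component (hx : x ∈ T) : ∃ C ∈ components T, x ∈ C := by
  classical
  refine ⟨T.filter fun y => Finset.uIcc x y ⊆ T, mem_components.2 ⟨x, hx, by simp⟩, ?_⟩
  simp [hx]

lemma component_unique (hC : C ∈ components T) (hC' : C' ∈ components T) (hx : x ∈ C)
    (hx' : x ∈ C') : C = C' := by
  ext y
  exact ⟨fun hy => mem_component_of_uIcc_subset hC' hx' (uIcc_subset_of_mem_component hC hx hy),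
    fun hy => mem_component_of_uIcc_subset hC hx (uIcc_subset_of_mem_component hC' hx' hy)⟩

variable {π : NCP} {J : Finset (Finset ℕ)}

/-- Since the blocks of `π` are disjoint, a component is a union of blocks exactly when it contains
every block of `J` that it meets. -/
lemma isIdeal_iff : IsIdeal π J ↔ J ⊆ π.blocks ∧ ∀ b ∈ J, ∀ C ∈ components (J.sup id),
    ∀ x ∈ b, x ∈ C → b ⊆ C := by
  refine and_congr_right fun hJ => ⟨fun h b hb C hC x hxb hxC => ?_, fun h C hC => ?_⟩
  · obtain ⟨B, hB, rfl⟩ := h C hC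
    obtain ⟨b', hb', hx'⟩ := mem_sup_iff.1 hxC
    rw [π.isNCFamily.eq_of_mem (hJ hb) (hB hb') hxb hx']
    exact subset_sup hb'
  · refine ⟨J.filter (· ⊆ C), (Finset.filter_subset _ _).trans hJ, ?_⟩
    ext x
    rw [mem_sup_iff]
    constructor
    · intro hx
      obtain ⟨b, hb, hxb⟩ := mem_sup_iff.1 (subset_of_mem_components hC hx)
      exact ⟨b, Finset.mem_filter.2 ⟨hb, h b hb C hC x hxb hx⟩, hxb⟩
    · rintro ⟨b, hb, hxb⟩
      exact (Finset.mem_filter.1 hb).2 hxb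

lemma IsIdeal.sup_filter (h : IsIdeal π J) (hC : C ∈ components (J.sup id)) :
    (J.filter (· ⊆ C)).sup id = C := by
  ext x
  rw [mem_sup_iff]
  constructor
  · rintro ⟨b, hb, hxb⟩
    exact (Finset.mem_filter.1 hb).2 hxb
  · intro hx
    obtain ⟨b, hb, hxb⟩ := mem_sup_iff.1 (subset_of_mem_components hC hx)
    exact ⟨b, Finset.mem_filter.2 ⟨hb, (isIdeal_iff.1 h).2 b hb C hC x hxb hx⟩, hxb⟩

end Components

/-! ### Compatibility of the word count with the first coproduct -/

section FirstCoproduct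

variable {π : NCP} {J : Finset (Finset ℕ)} {γ : Type*} [LinearOrder γ]

/-- A subfamily is recovered from its support; hence a word determines its ideal. -/
lemma IsNCFamily.eq_filter {B : Finset (Finset ℕ)} (h : IsNCFamily B) (hJ : J ⊆ B) :
    J = B.filter (· ⊆ J.sup id) := by
  ext b
  rw [Finset.mem_filter]
  refine ⟨fun hb => ⟨hJ hb, subset_sup hb⟩, fun hb => ?_⟩
  obtain ⟨x, hx⟩ := h.nonempty hb.1
  obtain ⟨b', hb', hx'⟩ := mem_sup_iff.1 (hb.2 hx)
  rwa [h.eq_of_mem hb.1 (hJ hb') hx hx']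

lemma sup_subset_Icc (hJ : J ⊆ π.blocks) : J.sup id ⊆ Finset.Icc 1 π.size := by
  rw [← π.sup_blocks]
  exact Finset.sup_mono hJ

lemma mem_sup_sdiff_iff (hJ : J ⊆ π.blocks) {x : ℕ} (hx : x ∈ Finset.Icc 1 π.size) :
    x ∈ (π.blocks \ J).sup id ↔ x ∉ J.sup id := by
  simp only [mem_sup_iff, Finset.mem_sdiff]
  constructor
  · rintro ⟨b, ⟨hb, hbJ⟩, hxb⟩ ⟨b', hb', hxb'⟩
    exact hbJ (π.isNCFamily.eq_of_mem hb (hJ hb') hxb hxb' ▸ hb')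
  · intro h
    obtain ⟨b, hb⟩ := π.exists_block hx
    exact ⟨b, ⟨b.2, fun hbJ => h ⟨b, hbJ, hb⟩⟩, hb⟩

/-- The positions of large letters of `g` are those of the blocks of `J`, and the restrictions of
`g` outside `⋃ J` and to the components of `⋃ J` have the expected associated equivalences. -/
def SplitsAt (π : NCP) (hi : γ → Prop) (J : Finset (Finset ℕ))
    (g : Finset.Icc 1 π.size → γ) : Prop :=
  (∀ x, hi (g x) ↔ x.1 ∈ J.sup id) ∧ Codes g ((π.blocks \ J).sup id) (π.blocks \ J) ∧
    ∀ C ∈ components (J.sup id), Codes g C (J.filter (· ⊆ C))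

/-- Once the positions of large letters are fixed, the small part and the word on each component are
chosen independently. -/
lemma card_splitsAt (hJ : IsIdeal π J) (hi : γ → Prop) :
    Nat.card {g // SplitsAt π hi J g} =
      famCount ((π.blocks \ J).sup id) (π.blocks \ J) {c // ¬ hi c} *
        ∏ C ∈ components (J.sup id), famCount C (J.filter (· ⊆ C)) {c // hi c} := by
  have hT : J.sup id ⊆ Finset.Icc 1 π.size := sup_subset_Icc hJ.1
  have hU : (π.blocks \ J).sup id ⊆ Finset.Icc 1 π.size :=
    sup_subset_Icc Finset.sdiff_subset
  simp only [famCount, wordCount_subtype]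
  have hprod : ∏ C ∈ components (J.sup id), Nat.card {g : C → {c // hi c} //
      ∀ x y : C, fiberRel (fun z => (g z).1) x y ↔ blockRel (J.filter (· ⊆ C)) x y} =
      Nat.card {g : ↥(J.sup id) → {c // hi c} // ∀ (C : Finset ℕ) (hC : C ∈ components (J.sup id)),
        ∀ x y : C, fiberRel (fun z : C => (g ⟨z, subset_of_mem_components hC z.2⟩).1) x y ↔
          blockRel (J.filter (· ⊆ C)) x y} :=
    prod_card_subtype_eq (components (J.sup id)) (fun C => C) (J.sup id)
      (fun C hC => subset_of_mem_components hC) (fun x hx => exists_component hx)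
      (fun C hC C' hC' x hx hx' => component_unique hC hC' hx hx')
      (fun C (h : C → {c // hi c}) => ∀ x y : C,
        fiberRel (fun z => (h z).1) x y ↔ blockRel (J.filter (· ⊆ C)) x y)
  have hglue := card_glue hi hU hT (fun x hx => mem_sup_sdiff_iff hJ.1 hx)
      (fun g => ∀ x y, fiberRel g x y ↔ blockRel (π.blocks \ J) x y)
      (fun g => ∀ (C : Finset ℕ) (hC : C ∈ components (J.sup id)), ∀ x y : C,
        fiberRel (fun z : C => g ⟨z, subset_of_mem_components hC z.2⟩) x y ↔
          blockRel (J.filter (· ⊆ C)) x y)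
  rw [hprod, ← hglue]
  refine Nat.card_congr (Equiv.subtypeEquivRight fun g => and_congr_right fun _ =>
    and_congr (codes_iff hU) (forall_congr' fun C => forall_congr' fun hC => ?_))
  exact codes_iff ((subset_of_mem_components hC).trans hT)

lemma uIcc_coe_subset_Icc {N : ℕ} (x y : Finset.Icc 1 N) :
    Finset.uIcc x.1 y.1 ⊆ Finset.Icc 1 N := by
  have hx := Finset.mem_Icc.1 x.2
  have hy := Finset.mem_Icc.1 y.2
  intro t ht
  rw [Finset.mem_uIcc'] at ht
  rw [Finset.mem_Icc]
  omega

lemma coe_mem_uIcc {S : Finset ℕ} {x y z : S} :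
    z.1 ∈ Finset.uIcc x.1 y.1 ↔ z ∈ Set.uIcc x y := by
  rw [Finset.mem_uIcc', Set.mem_uIcc]
  rfl

section

variable {hi : γ → Prop} {g : Finset.Icc 1 π.size → γ}

/-- Inside a component of the set of positions of large letters, the condition on a word is
local. -/
lemma fiberRel_iff_of_mem_component {T C : Finset ℕ} (hC : C ∈ components T)
    {x y : Finset.Icc 1 π.size} (hx : x.1 ∈ C) (hy : y.1 ∈ C) :
    fiberRel g x y ↔
      (g x = g y ∧ ∀ z : Finset.Icc 1 π.size, z.1 ∈ C → z ∈ Set.uIcc x y → g x ≤ g z) :=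
  and_congr_right fun _ => ⟨fun h z _ hz => h z hz, fun h z hz =>
    h z (uIcc_subset_component hC hx hy (coe_mem_uIcc.2 hz)) hz⟩

/-- Large letters never separate two small ones, so the positions of `⋃ J` can be deleted. -/
lemma fiberRel_iff_of_not_hi (hhi : ∀ a b, hi a → ¬ hi b → b ≤ a)
    (hT : ∀ x, hi (g x) ↔ x.1 ∈ J.sup id) (hJ : J ⊆ π.blocks) {x y : Finset.Icc 1 π.size}
    (hx : x.1 ∉ J.sup id) :
    fiberRel g x y ↔ (g x = g y ∧ ∀ z : Finset.Icc 1 π.size, z.1 ∈ (π.blocks \ J).sup id →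
      z ∈ Set.uIcc x y → g x ≤ g z) := by
  refine and_congr_right fun _ => ⟨fun h z _ hz => h z hz, fun h z hz => ?_⟩
  by_cases hzT : z.1 ∈ J.sup id
  · exact hhi _ _ ((hT z).2 hzT) fun h => hx ((hT x).1 h)
  · exact h z ((mem_sup_sdiff_iff hJ z.2).2 hzT) hz

lemma blockRel_sdiff_iff {B : Finset (Finset ℕ)} {x y : ℕ} (hx : x ∉ J.sup id) :
    blockRel (B \ J) x y ↔ blockRel B x y := by
  refine exists_congr fun b => ⟨fun h => ⟨(Finset.mem_sdiff.1 h.1).1, h.2⟩, fun h =>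
    ⟨Finset.mem_sdiff.2 ⟨h.1, fun hb => hx (subset_sup hb h.2.1)⟩, h.2⟩⟩

lemma blockRel_filter_iff (hJ : IsIdeal π J) {C : Finset ℕ} (hC : C ∈ components (J.sup id))
    {x y : ℕ} (hx : x ∈ C) :
    blockRel (J.filter (· ⊆ C)) x y ↔ blockRel π.blocks x y := by
  refine exists_congr fun b => ⟨fun h => ⟨hJ.1 (Finset.mem_filter.1 h.1).1, h.2⟩, fun h => ?_⟩
  obtain ⟨b', hb', hx'⟩ := mem_sup_iff.1 (subset_of_mem_components hC hx)
  obtain rfl := π.isNCFamily.eq_of_mem h.1 (hJ.1 hb') h.2.1 hx'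
  exact ⟨Finset.mem_filter.2 ⟨hb', (isIdeal_iff.1 hJ).2 b hb' C hC x hx' hx⟩, h.2⟩

lemma SplitsAt.fiberRel_iff (hhi : ∀ a b, hi a → ¬ hi b → b ≤ a) (hJ : IsIdeal π J)
    (h : SplitsAt π hi J g) (x y : Finset.Icc 1 π.size) :
    fiberRel g x y ↔ blockRel π.blocks x y := by
  obtain ⟨hT, hU, hC⟩ := h
  have hrel (x y : ℕ) (hx : x ∈ J.sup id) (hxy : blockRel π.blocks x y) : y ∈ J.sup id := by
    obtain ⟨b, hb, hxb, hyb⟩ := hxy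
    obtain ⟨b', hb', hxb'⟩ := mem_sup_iff.1 hx
    obtain rfl := π.isNCFamily.eq_of_mem hb (hJ.1 hb') hxb hxb'
    exact subset_sup hb' hyb
  have hrel' (x y : ℕ) (hxy : blockRel π.blocks x y) : blockRel π.blocks y x := by
    obtain ⟨b, hb, hxb, hyb⟩ := hxy
    exact ⟨b, hb, hyb, hxb⟩
  by_cases hx : x.1 ∈ J.sup id
  · obtain ⟨C, hCJ, hxC⟩ := exists_component hx
    by_cases hy : y.1 ∈ C
    · rw [fiberRel_iff_of_mem_component hCJ hxC hy, hC C hCJ x y hxC hy,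
        blockRel_filter_iff hJ hCJ hxC]
    · refine ⟨fun h => (hy ?_).elim, fun h => (hy ?_).elim⟩
      -- Letters between related positions are at least the large letter `g x`, hence large; the
      -- interval stays in `⋃ J` and cannot leave `C`.
      · refine mem_component_of_uIcc_subset hCJ hxC fun t ht => ?_
        have htS := uIcc_coe_subset_Icc x y ht
        have hle := h.2 ⟨t, htS⟩ (coe_mem_uIcc.1 ht)
        refine (hT ⟨t, htS⟩).1 ?_
        by_contra hlo
        have := le_antisymm hle (hhi _ _ ((hT x).2 hx) hlo)
        exact hlo (this ▸ (hT x).2 hx)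
      · obtain ⟨b, hb, hxb, hyb⟩ := (blockRel_filter_iff hJ hCJ hxC).2 h
        exact (Finset.mem_filter.1 hb).2 hyb
  · by_cases hy : y.1 ∈ J.sup id
    · refine ⟨fun h => (hx ?_).elim, fun h => (hx (hrel _ _ hy (hrel' _ _ h))).elim⟩
      exact (hT x).1 (h.1 ▸ (hT y).2 hy)
    · rw [fiberRel_iff_of_not_hi hhi hT hJ.1 hx,
        hU x y ((mem_sup_sdiff_iff hJ.1 x.2).2 hx) ((mem_sup_sdiff_iff hJ.1 y.2).2 hy),
        blockRel_sdiff_iff hx]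

/-- `J` consists of the blocks carrying large letters. Between two points of such a block all
letters are at least as large, so its span lies in one component: this is the ideal property. -/
lemma exists_splitsAt (hhi : ∀ a b, hi a → ¬ hi b → b ≤ a)
    (hup : ∀ a b, hi a → a ≤ b → hi b)
    (h : ∀ x y, fiberRel g x y ↔ blockRel π.blocks x y) :
    ∃ J, IsIdeal π J ∧ SplitsAt π hi J g := by
  classical
  let T : Finset ℕ := (Finset.univ.filter fun x => hi (g x)).image Subtype.val
  have hmemT (x : Finset.Icc 1 π.size) : x.1 ∈ T ↔ hi (g x) := by simp [T]
  let J := π.blocks.filter (· ⊆ T)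
  have hTS : T ⊆ Finset.Icc 1 π.size := by
    intro x hx
    obtain ⟨y, -, rfl⟩ := Finset.mem_image.1 hx
    exact y.2
  have hJT : J.sup id = T := by
    ext x
    rw [mem_sup_iff]
    constructor
    · rintro ⟨b, hb, hxb⟩
      exact (Finset.mem_filter.1 hb).2 hxb
    · intro hx
      obtain ⟨b, hxb⟩ := π.exists_block (hTS hx)
      refine ⟨b, Finset.mem_filter.2 ⟨b.2, fun y hyb => ?_⟩, hxb⟩
      have hxy := (h ⟨x, hTS hx⟩ ⟨y, π.mem_Icc_of_mem b hyb⟩).2 ⟨b, b.2, hxb, hyb⟩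
      exact (hmemT ⟨y, π.mem_Icc_of_mem b hyb⟩).2 (hxy.1 ▸ (hmemT ⟨x, hTS hx⟩).1 hx)
  have hT (x) : hi (g x) ↔ x.1 ∈ J.sup id := by rw [hJT, hmemT]
  have hJ : IsIdeal π J := by
    refine isIdeal_iff.2 ⟨Finset.filter_subset _ _, fun b hb C hC x hxb hxC y hyb => ?_⟩
    have hbπ : b ∈ π.blocks := (Finset.mem_filter.1 hb).1
    let x' : Finset.Icc 1 π.size := ⟨x, π.mem_Icc_of_mem ⟨b, hbπ⟩ hxb⟩
    let y' : Finset.Icc 1 π.size := ⟨y, π.mem_Icc_of_mem ⟨b, hbπ⟩ hyb⟩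
    have hxy : fiberRel g x' y' := (h x' y').2 ⟨b, hbπ, hxb, hyb⟩
    refine mem_component_of_uIcc_subset hC hxC fun t ht => ?_
    have htS := uIcc_coe_subset_Icc x' y' ht
    exact (hT ⟨t, htS⟩).1 (hup _ _ ((hT x').2 (subset_of_mem_components hC hxC))
      (hxy.2 ⟨t, htS⟩ (coe_mem_uIcc.1 ht)))
  refine ⟨J, hJ, hT, fun x y hx hy => ?_, fun C hC x y hx hy => ?_⟩
  · have hx' := (mem_sup_sdiff_iff hJ.1 x.2).1 hx
    rw [← fiberRel_iff_of_not_hi hhi hT hJ.1 hx', h, blockRel_sdiff_iff hx']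
  · rw [← fiberRel_iff_of_mem_component hC hx hy, h, blockRel_filter_iff hJ hC hx]

end

-- The letters of `Fin (m + n)` with value at least `m` are declared large; each word coding `π`
-- then splits along exactly one ideal.
open Classical in
lemma famCount_eq_sum_ideals (π : NCP) (m n : ℕ) :
    famCount (Finset.Icc 1 π.size) π.blocks (Fin (m + n)) =
      ∑ J ∈ π.blocks.powerset with IsIdeal π J,
        famCount ((π.blocks \ J).sup id) (π.blocks \ J) (Fin m) *
          ∏ C ∈ components (J.sup id), famCount C (J.filter (· ⊆ C)) (Fin n) := by
  let hi : Fin (m + n) → Prop := fun c => m ≤ c.1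
  have hcard : Fintype.card {c : Fin (m + n) // hi c} = n := by
    have e : Fin n ≃ {c : Fin (m + n) // hi c} :=
      { toFun := fun i => ⟨Fin.natAdd m i, by simp [hi]⟩
        invFun := fun c => ⟨c.1.1 - m, by have := c.1.2; have := c.2; omega⟩
        left_inv := fun i => by simp
        right_inv := fun c => Subtype.ext (Fin.ext (Nat.add_sub_cancel' c.2)) }
    rw [← Fintype.card_congr e, Fintype.card_fin]
  have hcard' : Fintype.card {c : Fin (m + n) // ¬ hi c} = m := by
    rw [Fintype.card_subtype_compl, hcard]; simp
  have hhi (a b : Fin (m + n)) (ha : hi a) (hb : ¬ hi b) : b ≤ a :=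
    ((not_le.1 hb).trans_le ha).le
  have hup (a b : Fin (m + n)) (ha : hi a) (hab : a ≤ b) : hi b := le_trans ha hab
  unfold famCount
  rw [wordCount, card_subtype_eq_sum (π.blocks.powerset.filter (IsIdeal π)) (SplitsAt π hi)]
  · refine Finset.sum_congr rfl fun J hJ => ?_
    rw [card_splitsAt (Finset.mem_filter.1 hJ).2]
    simp only [famCount, wordCount_eq_fin hcard, wordCount_eq_fin hcard']
  · intro g
    constructor
    · intro h
      obtain ⟨J, hJ, hg⟩ := exists_splitsAt hhi hup h
      exact ⟨J, Finset.mem_filter.2 ⟨Finset.mem_powerset.2 hJ.1, hJ⟩, hg⟩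
    · rintro ⟨J, hJ, hg⟩
      exact hg.fiberRel_iff hhi (Finset.mem_filter.1 hJ).2
  · intro g J hJ J' hJ' h h'
    have hJ := (Finset.mem_filter.1 hJ).2.1
    have hJ' := (Finset.mem_filter.1 hJ').2.1
    have hsup : J.sup id = J'.sup id := by
      ext x
      constructor
      · intro hx
        have hxS : x ∈ Finset.Icc 1 π.size := sup_subset_Icc hJ hx
        exact (h'.1 ⟨x, hxS⟩).1 ((h.1 ⟨x, hxS⟩).2 hx)
      · intro hx
        have hxS : x ∈ Finset.Icc 1 π.size := sup_subset_Icc hJ' hx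
        exact (h.1 ⟨x, hxS⟩).1 ((h'.1 ⟨x, hxS⟩).2 hx)
    rw [π.isNCFamily.eq_filter hJ, π.isNCFamily.eq_filter hJ', hsup]

end FirstCoproduct

/-! ### Compatibility of the word count with the second coproduct -/

section SecondCoproduct

variable {π : NCP} {σ : Finpartition π.blocks} {α β : Type*} [LinearOrder α] [LinearOrder β]

lemma blockRel_contract_iff {x y : ℕ} :
    blockRel (contract σ) x y ↔ ∃ c ∈ σ.parts, x ∈ c.sup id ∧ y ∈ c.sup id := by
  simp only [blockRel, contract, Finset.exists_mem_image]

lemma sup_class_subset {c : Finset (Finset ℕ)} (hc : c ∈ σ.parts) :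
    c.sup id ⊆ Finset.Icc 1 π.size :=
  sup_subset_Icc (σ.le hc)

lemma exists_class {x : ℕ} (hx : x ∈ Finset.Icc 1 π.size) : ∃ c ∈ σ.parts, x ∈ c.sup id := by
  obtain ⟨b, hb⟩ := π.exists_block hx
  obtain ⟨c, hc, hbc⟩ := σ.exists_mem b.2
  exact ⟨c, hc, mem_sup_iff.2 ⟨b, hbc, hb⟩⟩

lemma mem_class_of_mem {c : Finset (Finset ℕ)} (hc : c ∈ σ.parts) {x : ℕ} (hx : x ∈ c.sup id)
    {b : Finset ℕ} (hb : b ∈ π.blocks) (hxb : x ∈ b) : b ∈ c := by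
  obtain ⟨b', hb', hx'⟩ := mem_sup_iff.1 hx
  rwa [π.isNCFamily.eq_of_mem hb (σ.le hc hb') hxb hx']

lemma class_unique {c c' : Finset (Finset ℕ)} (hc : c ∈ σ.parts) (hc' : c' ∈ σ.parts) {x : ℕ}
    (hx : x ∈ c.sup id) (hx' : x ∈ c'.sup id) : c = c' := by
  obtain ⟨b, hb, hxb⟩ := mem_sup_iff.1 hx
  exact σ.eq_of_mem_parts hc hc' hb (mem_class_of_mem hc' hx' (σ.le hc hb) hxb)

lemma isNCFamily_contract (h : IsNoncrossing (contract σ)) : IsNCFamily (contract σ) where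
  empty_notMem := by
    intro h0
    obtain ⟨c, hc, hc0⟩ := Finset.mem_image.1 h0
    obtain ⟨b, hb⟩ := σ.nonempty_of_mem_parts hc
    obtain ⟨x, hx⟩ := π.isNCFamily.nonempty (σ.le hc hb)
    have : x ∈ c.sup id := mem_sup_iff.2 ⟨b, hb, hx⟩
    simp [hc0] at this
  pairwiseDisjoint := by
    intro C hC C' hC' hne
    obtain ⟨c, hc, rfl⟩ := Finset.mem_image.1 (Finset.mem_coe.1 hC)
    obtain ⟨c', hc', rfl⟩ := Finset.mem_image.1 (Finset.mem_coe.1 hC')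
    exact Finset.disjoint_left.2 fun x hx hx' => hne (by rw [class_unique hc hc' hx hx'])
  noncrossing := h

lemma sup_contract : (contract σ).sup id = Finset.Icc 1 π.size := by
  ext x
  rw [mem_sup_iff]
  constructor
  · rintro ⟨C, hC, hx⟩
    obtain ⟨c, hc, rfl⟩ := Finset.mem_image.1 hC
    exact sup_class_subset hc hx
  · intro hx
    obtain ⟨c, hc, hxc⟩ := exists_class (σ := σ) hx
    exact ⟨_, Finset.mem_image_of_mem _ hc, hxc⟩

lemma blockRel_class_iff {c : Finset (Finset ℕ)} (hc : c ∈ σ.parts) {x y : ℕ}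
    (hx : x ∈ c.sup id) : blockRel c x y ↔ blockRel π.blocks x y :=
  exists_congr fun _ => ⟨fun h => ⟨σ.le hc h.1, h.2⟩, fun h =>
    ⟨mem_class_of_mem hc hx h.1 h.2.1, h.2⟩⟩

/-- The word of first letters of `g` has associated equivalence `π/σ`, and the words of second
letters on the classes of `σ` have the expected associated equivalences. -/
def MergesAlong (σ : Finpartition π.blocks) (g : Finset.Icc 1 π.size → α ×ₗ β) : Prop :=
  (∀ x y, fiberRel (fun x => (ofLex (g x)).1) x y ↔ blockRel (contract σ) x y) ∧
    ∀ c ∈ σ.parts, Codes (fun x => (ofLex (g x)).2) (c.sup id) c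

lemma card_mergesAlong (σ : Finpartition π.blocks) (α β : Type*) [LinearOrder α]
    [LinearOrder β] :
    Nat.card {g : Finset.Icc 1 π.size → α ×ₗ β // MergesAlong σ g} =
      famCount (Finset.Icc 1 π.size) (contract σ) α *
        ∏ c ∈ σ.parts, famCount (c.sup id) c β := by
  have hprod : ∏ c ∈ σ.parts, Nat.card {g : ↥(c.sup id) → β //
      ∀ x y : ↥(c.sup id), fiberRel g x y ↔ blockRel c x y} =
      Nat.card {g : Finset.Icc 1 π.size → β // ∀ (c : Finset (Finset ℕ)) (hc : c ∈ σ.parts),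
        ∀ x y : ↥(c.sup id), fiberRel (fun z : ↥(c.sup id) => g ⟨z, sup_class_subset hc z.2⟩) x y ↔
          blockRel c x y} :=
    prod_card_subtype_eq σ.parts (fun c => c.sup id) (Finset.Icc 1 π.size)
      (fun c hc => sup_class_subset hc) (fun x hx => exists_class hx)
      (fun c hc c' hc' x hx hx' => class_unique hc hc' hx hx')
      (fun c (h : ↥(c.sup id) → β) => ∀ x y : ↥(c.sup id), fiberRel h x y ↔ blockRel c x y)
  simp only [famCount, wordCount]
  rw [hprod, ← Nat.card_prod]
  refine Nat.card_congr
    { toFun := fun g => (⟨fun x => (ofLex (g.1 x)).1, g.2.1⟩,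
        ⟨fun x => (ofLex (g.1 x)).2, fun c hc => (codes_iff (sup_class_subset hc)).1 (g.2.2 c hc)⟩)
      invFun := fun g => ⟨fun x => toLex (g.1.1 x, g.2.1 x), g.1.2, fun c hc =>
        (codes_iff (sup_class_subset hc)).2 (g.2.2 c hc)⟩
      left_inv := fun g => rfl
      right_inv := fun g => rfl }

variable {g : Finset.Icc 1 π.size → α ×ₗ β}

lemma fiberRel.fst {X : Type*} [LinearOrder X] {g : X → α ×ₗ β} {x y : X} (h : fiberRel g x y) :
    fiberRel (fun x => (ofLex (g x)).1) x y :=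
  ⟨by simp only [h.1], fun z hz => (Prod.Lex.le_iff.1 (h.2 z hz)).elim le_of_lt
    fun h => h.1.le⟩

/-- Inside a class of the equivalence of the first letters, the condition on a word is a condition
on its second letters. -/
lemma fiberRel_iff_of_mem_class
    (H : ∀ x y, fiberRel (fun x => (ofLex (g x)).1) x y ↔ blockRel (contract σ) x y)
    {c : Finset (Finset ℕ)} (hc : c ∈ σ.parts) {x y : Finset.Icc 1 π.size} (hx : x.1 ∈ c.sup id)
    (hy : y.1 ∈ c.sup id) :
    fiberRel g x y ↔ ((ofLex (g x)).2 = (ofLex (g y)).2 ∧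
      ∀ z : Finset.Icc 1 π.size, z.1 ∈ c.sup id → z ∈ Set.uIcc x y →
        (ofLex (g x)).2 ≤ (ofLex (g z)).2) := by
  have hrel {z : Finset.Icc 1 π.size} (hz : z.1 ∈ c.sup id) :
      fiberRel (fun x => (ofLex (g x)).1) x z :=
    (H x z).2 (blockRel_contract_iff.2 ⟨c, hc, hx, hz⟩)
  constructor
  · intro h
    refine ⟨by rw [h.1], fun z hzc hz => ?_⟩
    rcases Prod.Lex.le_iff.1 (h.2 z hz) with h' | h'
    · exact absurd (hrel hzc).1 h'.ne
    · exact h'.2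
  · intro h
    refine ⟨Prod.ext (hrel hy).1 h.1, fun z hz => Prod.Lex.le_iff.2 ?_⟩
    rcases ((hrel hy).2 z hz).lt_or_eq with h' | h'
    · exact .inl h'
    -- A tie of first letters puts `z` in the class `c`, where the hypothesis on second letters
    -- applies.
    · obtain ⟨c', hc', hx', hz'⟩ := blockRel_contract_iff.1
        ((H x z).1 ((hrel hy).of_mem_uIcc hz h'.symm))
      obtain rfl := class_unique hc hc' hx hx'
      exact .inr ⟨h', h.2 z hz' hz⟩

lemma MergesAlong.fiberRel_iff (h : MergesAlong σ g) (x y : Finset.Icc 1 π.size) :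
    fiberRel g x y ↔ blockRel π.blocks x y := by
  obtain ⟨c, hc, hx⟩ := exists_class (σ := σ) x.2
  by_cases hy : y.1 ∈ c.sup id
  · rw [fiberRel_iff_of_mem_class h.1 hc hx hy, h.2 c hc x y hx hy, blockRel_class_iff hc hx]
  · refine ⟨fun h' => (hy ?_).elim, fun h' => (hy ?_).elim⟩
    · obtain ⟨c', hc', hx', hy'⟩ := blockRel_contract_iff.1 ((h.1 x y).1 h'.fst)
      exact class_unique hc hc' hx hx' ▸ hy'
    · obtain ⟨b, hb, hxb, hyb⟩ := (blockRel_class_iff hc hx).2 h'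
      exact subset_sup hb hyb

/-- The equivalence of `f` is coarser than that of `π`, so its classes are unions of blocks, and it
descends to the set of blocks. -/
lemma exists_contract_of_fiberRel (f : Finset.Icc 1 π.size → α)
    (hf : ∀ x y : Finset.Icc 1 π.size, blockRel π.blocks x y → fiberRel f x y) :
    ∃ σ : Finpartition π.blocks, ∀ x y : Finset.Icc 1 π.size,
      fiberRel f x y ↔ blockRel (contract σ) x y := by
  classical
  -- `κ b` is the class of `f` containing `b`; two blocks are merged when these classes agree.
  let κ (b : Finset ℕ) : Set (Finset.Icc 1 π.size) := {y | ∃ x, x.1 ∈ b ∧ fiberRel f x y}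
  let σ := Finpartition.ofSetSetoid (Setoid.ker κ) π.blocks
  have hκ (x : Finset.Icc 1 π.size) : κ (π.blockOf x).1 = {y | fiberRel f x y} := by
    ext y
    constructor
    · rintro ⟨x', hx', h⟩
      exact (hf x x' ⟨_, (π.blockOf x).2, π.mem_blockOf x, hx'⟩).trans h
    · exact fun h => ⟨x, π.mem_blockOf x, h⟩
  refine ⟨σ, fun x y => ?_⟩
  have h1 : fiberRel f x y ↔ κ (π.blockOf x).1 = κ (π.blockOf y).1 := by
    rw [hκ, hκ]
    constructor
    · exact fun h => Set.ext fun z => ⟨fun h' => h.symm.trans h', fun h' => h.trans h'⟩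
    · intro h
      have : y ∈ {z | fiberRel f x z} := h ▸ fiberRel_refl f y
      exact this
  rw [h1, blockRel_contract_iff]
  have h2 := Finpartition.mem_part_ofSetSetoid_iff_rel (s := Setoid.ker κ) (a := (π.blockOf x).1)
    (b := (π.blockOf y).1) π.blocks
  rw [Finpartition.mem_part_iff_exists] at h2
  constructor
  · intro h
    obtain ⟨c, hc, hyc, hxc⟩ := h2.2 ⟨(π.blockOf x).2, (π.blockOf y).2, h⟩
    exact ⟨c, hc, subset_sup hxc (π.mem_blockOf x), subset_sup hyc (π.mem_blockOf y)⟩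
  · rintro ⟨c, hc, hx, hy⟩
    exact (h2.1 ⟨c, hc, mem_class_of_mem hc hy (π.blockOf y).2 (π.mem_blockOf y),
      mem_class_of_mem hc hx (π.blockOf x).2 (π.mem_blockOf x)⟩).2.2

lemma isNoncrossing_contract (f : Finset.Icc 1 π.size → α)
    (H : ∀ x y : Finset.Icc 1 π.size, fiberRel f x y ↔ blockRel (contract σ) x y) :
    IsNoncrossing (contract σ) := by
  intro C hC C' hC' hne x hx z hz y hy t ht ⟨hxy, hyz, hzt⟩
  obtain ⟨c, hc, rfl⟩ := Finset.mem_image.1 hC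
  obtain ⟨c', hc', rfl⟩ := Finset.mem_image.1 hC'
  have h1 := (H ⟨x, sup_class_subset hc hx⟩ ⟨z, sup_class_subset hc hz⟩).2
    (blockRel_contract_iff.2 ⟨c, hc, hx, hz⟩)
  have h2 := (H ⟨y, sup_class_subset hc' hy⟩ ⟨t, sup_class_subset hc' ht⟩).2
    (blockRel_contract_iff.2 ⟨c', hc', hy, ht⟩)
  obtain ⟨d, hd, hxd, hyd⟩ := blockRel_contract_iff.1
    ((H _ _).1 (h1.of_lt_of_lt_of_lt h2 hxy hyz hzt))
  exact hne (by rw [class_unique hc hd hx hxd, class_unique hc' hd hy hyd])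

/-- Passing to first letters coarsens the equivalence, so `σ` is read off from the word of first
letters; it is noncrossing like every equivalence coming from a word. -/
lemma exists_mergesAlong (h : ∀ x y, fiberRel g x y ↔ blockRel π.blocks x y) :
    ∃ σ : Finpartition π.blocks, IsNoncrossing (contract σ) ∧ MergesAlong σ g := by
  obtain ⟨σ, hσ⟩ := exists_contract_of_fiberRel (fun x => (ofLex (g x)).1)
    fun x y hxy => ((h x y).2 hxy).fst
  refine ⟨σ, isNoncrossing_contract _ hσ, hσ, fun c hc x y hx hy => ?_⟩
  rw [← fiberRel_iff_of_mem_class hσ hc hx hy, h, blockRel_class_iff hc hx]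

lemma eq_of_blockRel_contract {σ τ : Finpartition π.blocks}
    (h : ∀ x y : Finset.Icc 1 π.size,
      blockRel (contract σ) x y ↔ blockRel (contract τ) x y) : σ = τ := by
  have key {σ τ : Finpartition π.blocks} (h : ∀ x y : Finset.Icc 1 π.size,
      blockRel (contract σ) x y ↔ blockRel (contract τ) x y) {c c' : Finset (Finset ℕ)}
      (hc : c ∈ σ.parts) (hc' : c' ∈ τ.parts) {b : Finset ℕ} (hb : b ∈ c) (hb' : b ∈ c') :
      c ⊆ c' := by
    intro d hd
    obtain ⟨x, hx⟩ := π.isNCFamily.nonempty (σ.le hc hb)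
    obtain ⟨y, hy⟩ := π.isNCFamily.nonempty (σ.le hc hd)
    have hxc := mem_sup_iff.2 ⟨b, hb, hx⟩
    have hyc := mem_sup_iff.2 ⟨d, hd, hy⟩
    obtain ⟨c'', hc'', hx'', hy''⟩ := blockRel_contract_iff.1
      ((h ⟨x, sup_class_subset hc hxc⟩ ⟨y, sup_class_subset hc hyc⟩).1
        (blockRel_contract_iff.2 ⟨c, hc, hxc, hyc⟩))
    rw [class_unique hc' hc'' (mem_sup_iff.2 ⟨b, hb', hx⟩) hx'']
    exact mem_class_of_mem hc'' hy'' (σ.le hc hd) hy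
  have key' {σ τ : Finpartition π.blocks} (h : ∀ x y : Finset.Icc 1 π.size,
      blockRel (contract σ) x y ↔ blockRel (contract τ) x y) : σ.parts ⊆ τ.parts := by
    intro c hc
    obtain ⟨b, hb⟩ := σ.nonempty_of_mem_parts hc
    obtain ⟨c', hc', hb'⟩ := τ.exists_mem (σ.le hc hb)
    rwa [(key h hc hc' hb hb').antisymm (key (fun x y => (h x y).symm) hc' hc hb' hb)]
  exact Finpartition.ext ((key' h).antisymm (key' fun x y => (h x y).symm))

-- The alphabet of size `m * n` is realized as `Fin m ×ₗ Fin n`; each word coding `π` merges along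
-- exactly one `σ`.
open Classical in
lemma famCount_eq_sum_contract (π : NCP) (m n : ℕ) :
    famCount (Finset.Icc 1 π.size) π.blocks (Fin (m * n)) =
      ∑ σ : Finpartition π.blocks with IsNoncrossing (contract σ),
        famCount (Finset.Icc 1 π.size) (contract σ) (Fin m) *
          ∏ c ∈ σ.parts, famCount (c.sup id) c (Fin n) := by
  have hcard : Fintype.card (Fin m ×ₗ Fin n) = m * n := by simp
  rw [famCount, ← wordCount_eq_fin hcard, wordCount,
    card_subtype_eq_sum (Finset.univ.filter fun σ : Finpartition π.blocks =>
      IsNoncrossing (contract σ)) MergesAlong]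
  · exact Finset.sum_congr rfl fun σ _ => card_mergesAlong σ _ _
  · intro g
    constructor
    · intro h
      obtain ⟨σ, hσ, hg⟩ := exists_mergesAlong h
      exact ⟨σ, Finset.mem_filter.2 ⟨Finset.mem_univ _, hσ⟩, hg⟩
    · rintro ⟨σ, -, hg⟩
      exact hg.fiberRel_iff
  · intro g σ _ τ _ h h'
    exact eq_of_blockRel_contract fun x y => (h.1 x y).symm.trans (h'.1 x y)

end SecondCoproduct

/-! ### The chromatic morphism -/

section Morphism

variable (K : Type*) [Field K] [CharZero K]

/-- The polynomial counting the words with associated noncrossing partition `π`. -/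
noncomputable def chromPoly (π : NCP) : Polynomial K :=
  (exists_polynomial_eval_eq_wordCount K
    (fun x y : Finset.Icc 1 π.size => blockRel π.blocks x y)).choose

lemma eval_chromPoly (π : NCP) (n : ℕ) : (chromPoly K π).eval (n : K) =
    (famCount (Finset.Icc 1 π.size) π.blocks (Fin n) : K) :=
  (exists_polynomial_eval_eq_wordCount K
    (fun x y : Finset.Icc 1 π.size => blockRel π.blocks x y)).choose_spec n

/-- The morphism sending a noncrossing partition to its chromatic polynomial. -/
noncomputable def chromHom : Alg K →ₐ[K] Polynomial K := MvPolynomial.aeval (chromPoly K)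

lemma evalAt_chromHom_X (n : ℕ) (π : NCP) : evalAt (chromHom K) (n : K) (MvPolynomial.X π) =
    (famCount (Finset.Icc 1 π.size) π.blocks (Fin n) : K) := by
  rw [evalAt_apply, chromHom, MvPolynomial.aeval_X, eval_chromPoly]

variable {K} in
lemma evalAt_chromHom_elt (n : ℕ) {B : Finset (Finset ℕ)} (h : IsNCFamily B) :
    evalAt (chromHom K) (n : K) (elt K B) = (famCount (B.sup id) B (Fin n) : K) :=
  h.map_elt (evalAt_chromHom_X K n)

lemma chromHom_map_Δ :
    (polyΔ K).comp (chromHom K) =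
      (Algebra.TensorProduct.map (chromHom K) (chromHom K)).comp (coprodΔ K) := by
  classical
  refine MvPolynomial.algHom_ext fun π => tensor_ext_of_evalPair fun m n => ?_
  have h := DFunLike.congr_fun (evalPair_comp_map (chromHom K) (m : K) n)
    (coprodΔ K (MvPolynomial.X π))
  simp only [AlgHom.comp_apply] at h ⊢
  rw [h, evalPair_polyΔ, ← Nat.cast_add, ← evalAt_apply, evalAt_chromHom_X,
    famCount_eq_sum_ideals, coprodΔ, MvPolynomial.aeval_X, map_sum, Nat.cast_sum]
  refine Finset.sum_congr (by congr!) fun J hJ => ?_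
  have hJ := (Finset.mem_filter.1 hJ).2
  rw [tensorChar_tmul, evalAt_chromHom_elt _ (π.isNCFamily.mono Finset.sdiff_subset),
    dotRestrict, map_prod, Nat.cast_mul, Nat.cast_prod]
  congr 1
  refine Finset.prod_congr rfl fun C hC => ?_
  rw [evalAt_chromHom_elt _ (π.isNCFamily.mono ((Finset.filter_subset _ _).trans hJ.1)),
    hJ.sup_filter hC]

lemma chromHom_map_δ :
    (polyδ K).comp (chromHom K) =
      (Algebra.TensorProduct.map (chromHom K) (chromHom K)).comp (coprodδ K) := by
  classical
  refine MvPolynomial.algHom_ext fun π => tensor_ext_of_evalPair fun m n => ?_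
  have h := DFunLike.congr_fun (evalPair_comp_map (chromHom K) (m : K) n)
    (coprodδ K (MvPolynomial.X π))
  simp only [AlgHom.comp_apply] at h ⊢
  rw [h, evalPair_polyδ, ← Nat.cast_mul, ← evalAt_apply, evalAt_chromHom_X,
    famCount_eq_sum_contract, coprodδ, MvPolynomial.aeval_X, map_sum, Nat.cast_sum]
  refine Finset.sum_congr (by congr!) fun σ hσ => ?_
  have hσ := (Finset.mem_filter.1 hσ).2
  rw [tensorChar_tmul, evalAt_chromHom_elt _ (isNCFamily_contract hσ), sup_contract, map_prod,
    Nat.cast_mul, Nat.cast_prod]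
  congr 1
  exact Finset.prod_congr rfl fun c hc =>
    (evalAt_chromHom_elt _ (π.isNCFamily.mono (σ.le hc))).symm

lemma NCP.one_mem_Icc (π : NCP) : 1 ∈ Finset.Icc 1 π.size :=
  Finset.mem_Icc.2 ⟨le_rfl, π.size_pos⟩

lemma chromHom_map_counitΔ : (polyCounitΔ K).comp (chromHom K) = counitΔ K := by
  refine MvPolynomial.algHom_ext fun π => ?_
  have h := evalAt_chromHom_X K 0 π
  rw [Nat.cast_zero] at h
  refine h.trans ?_
  rw [counitΔ, MvPolynomial.aeval_X, Nat.cast_eq_zero, famCount, wordCount, Nat.card_eq_zero]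
  -- As `π` has at least one position, there is no word on the empty alphabet.
  exact .inl ⟨fun g => (g.1 ⟨1, π.one_mem_Icc⟩).elim0⟩

/-- The only word on one letter relates all positions, so it codes the one-block partition. -/
lemma famCount_fin_one (π : NCP) : famCount (Finset.Icc 1 π.size) π.blocks (Fin 1) =
    if π.blocks.card = 1 then 1 else 0 := by
  have hrel (g : Finset.Icc 1 π.size → Fin 1) (x y : Finset.Icc 1 π.size) : fiberRel g x y :=
    ⟨Subsingleton.elim _ _, fun z _ => (Subsingleton.elim (g x) (g z)).le⟩
  rw [famCount, wordCount]
  split_ifs with h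
  · rw [Nat.card_eq_one_iff_unique]
    refine ⟨inferInstance, ⟨fun _ => 0, fun x y => iff_of_true (hrel _ x y) ?_⟩⟩
    rw [π.blockRel_iff]
    have := Finset.card_le_one_iff_subsingleton_coe.1 h.le
    exact Subsingleton.elim _ _
  · rw [Nat.card_eq_zero]
    refine .inl ⟨fun g => h (Finset.card_eq_one.2 ?_)⟩
    refine ⟨(π.blockOf ⟨1, π.one_mem_Icc⟩).1, Finset.eq_singleton_iff_unique_mem.2
      ⟨Subtype.prop _, fun b hb => ?_⟩⟩
    let x : Finset.Icc 1 π.size := ⟨_, π.mem_Icc_of_mem ⟨b, hb⟩ (π.bmin_mem ⟨b, hb⟩)⟩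
    have hx : π.blockOf x = ⟨b, hb⟩ := π.blockOf_eq (π.bmin_mem ⟨b, hb⟩)
    have := (π.blockRel_iff x ⟨1, π.one_mem_Icc⟩).1 ((g.2 _ _).1 (hrel _ _ _))
    rw [← this, hx]

lemma chromHom_map_counitδ : (polyCounitδ K).comp (chromHom K) = counitδ K := by
  refine MvPolynomial.algHom_ext fun π => ?_
  have h := evalAt_chromHom_X K 1 π
  rw [Nat.cast_one] at h
  refine h.trans ?_
  rw [counitδ, MvPolynomial.aeval_X, famCount_fin_one]
  split_ifs <;> simp

lemma isDoubleBialgHom_chromHom : IsDoubleBialgHom (chromHom K) where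
  map_Δ := chromHom_map_Δ K
  map_counitΔ := chromHom_map_counitΔ K
  map_δ := chromHom_map_δ K
  map_counitδ := chromHom_map_counitδ K

end Morphism

end NoncrossingPartitions

open NoncrossingPartitions in
theorem proposition3p1 {K : Type*} [Field K] [CharZero K] :
    ∃ φ : Alg K →ₐ[K] Polynomial K,
      (IsDoubleBialgHom φ ∧ ∀ ψ : Alg K →ₐ[K] Polynomial K, IsDoubleBialgHom ψ → ψ = φ) ∧
      ∀ (π : NCP) (n : ℕ), 1 ≤ n →
        (φ (MvPolynomial.X π)).eval (n : K) =
          (Nat.card {f : π.blocks → Fin n // IsValidColoration π f} : K) := by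
  refine ⟨chromHom K, ⟨isDoubleBialgHom_chromHom K,
    fun ψ hψ => hψ.eq (isDoubleBialgHom_chromHom K)⟩, fun π n _ => ?_⟩
  rw [← evalAt_apply, evalAt_chromHom_X, card_isValidColoration]
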